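/- **Setting.** Let $k,n_s\ge 1$, let $\bar A_s\in\{0,*\}^{n_s\times n_s}$ be the common structured state matrix of $k$ subsystems with states $x^i_p$ ($1\le i\le k$, $1\le p\le n_s$), let $n_T=kn_s$, and let $\bar B\in\{0,*\}^{n_T\times 1}$ be a structured input matrix with input node $u$. A real matrix is a numerical realization of a structured matrix if it vanishes wherever the structured matrix has a $0$; a structured pair is structurally controllable if it has a controllable numerical realization. An interconnection is a directed edge $(x^j_q,x^i_p)$ with $i\ne j$. A set of interconnections determines a composite structured matrix $\bar A'$ with all diagonal blocks equal to $\bar A_s$. Assume that the composite system with all possible interconnections is structurally controllable with $\bar B$. **Problem 1.** Among all $\bar A'\in\{0,*\}^{n_T\times n_T}$ with diagonal blocks $\bar A_s$ for which $(\bar A',\bar B)$ is structurally controllable, find one with the fewest $*$ entries. $|\mathcal I^*|$ is the number of interconnections in such an $\bar A'$. **Notation.** A state is accessible, with respect to a set of interconnections, if there is a path to it from $u$ using edges inside subsystems, input edges and these interconnections. $\mathcal N$ is the set of strongly connected components (SCCs) of the subsystem digraphs that have no incoming edge from outside within the subsystem and are not accessible without interconnections; $q=|\mathcal N|$. The bipartite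 graph $\mathcal B(\bar A,\bar B)$ has left nodes $x'^i_p$, right nodes $x^i_p$ and $u$, and edges: $\mathcal E_X$, $(x'^i_p,x^i_q)$ when $(\bar A_s)_{pq}=*$, cost $1$; $\mathcal E_{\mathcal I}$, $(x'^i_p,x^j_q)$ for all $i\ne j$, cost $3$; $\mathcal E_U$, $(x'^i_p,u)$ when $\bar B$ has a $*$ at $x^i_p$, cost $0$. The graph $\mathcal B(\bar A,\bar B,\mathcal N)$ has in addition the right nodes $\mathcal N$ and the edges $(x'^i_p,\mathcal N_h)$ for $x^i_p\in\mathcal N_h$, cost $2$. A matching is perfect if its size is that of the smaller side; an optimum matching is a minimum cost perfect matching of $\mathcal B(\bar A,\bar B,\mathcal N)$, and $\beta_{\mathcal I}$ is the number of its edges in $\mathcal E_{\mathcal I}$. **Algorithm 1** (selections are arbitrary unless restricted). 1. Find an optimum matching $M^*$; put $M'=M^*\cap(\mathcal E_X\cup\mathcal E_U)$. Find a perfect matching $M''$ of the graph obtained from $\mathcal B(\bar A,\bar B)$ by deleting the nodes covered by $M'$. Put $\widetilde M=M'\cup M''$. 2. While there is a node $x'^i_p$ matched in $\widetilde M$ by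 an edge $(x'^i_p,x^j_q)\in\mathcal E_{\mathcal I}$ such that $x^i_p$ lies in some $\mathcal N_h\in\mathcal N$ that is not accessible with respect to the interconnections in $\widetilde M$: select such a node, and let $x^t_r$ be the state that is unmatched on the right in $\widetilde M$ and accessible with respect to the interconnections in $\widetilde M$. If $i\ne t$, replace $(x'^i_p,x^j_q)$ by $(x'^i_p,x^t_r)$ in $\widetilde M$. If $i=t$, choose an edge $(x'^j_s,x^w_v)\in\widetilde M$ with $w\neq j$ and replace it by $(x'^j_s,x^t_r)$. Call such a replacement effective if $\mathcal N_h$ is accessible afterwards. 3. Starting from the interconnections in $\widetilde M$, as long as some member of $\mathcal N$ is inaccessible with respect to the current set of interconnections, add one interconnection from a currently accessible state to a state of an inaccessible member of $\mathcal N$ in a different subsystem. Output the resulting set $\mathcal I_A$ of interconnections. **Theorem.** (i) Whatever choices are made, every output $\mathcal I_A$ of Algorithm 1 is an optimal solution of Problem 1: the composite system with interconnection set $\mathcal I_A$ is structurally controllable with $\bar B$, its structured state matrix has the fewest $*$ entries among all feasible ones, and $|\mathcal I_A|=|\mathcal I^*|=\beta_{\mathcal I}+q$, for every optimum matching used to define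 $\beta_{\mathcal I}$ and every optimal solution used to define $\mathcal I^*$. (ii) If in Step 2 only effective replacements are made, then every execution of Algorithm 1 terminates, and it never gets stuck: in every situation reached before an output is produced, the execution can be continued (in particular, an effective replacement exists for every node selected in Step 2). -/

import Mathlib

namespace StructComposite

/-! ### Structured systems and structural controllability

A structured matrix, an element of `{0, *}^(ι × κ)`, is a Boolean matrix whose entry is `true`
exactly at the positions marked `*`. -/

/-- The controllability matrix `[B, AB, ..., A^(N-1) B]`, `N` the dimension of the state space. -/
def controllabilityMatrix {ι κ : Type*} [Fintype ι] [DecidableEq ι]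
    (A : Matrix ι ι ℝ) (B : Matrix ι κ ℝ) : Matrix ι (Fin (Fintype.card ι) × κ) ℝ :=
  Matrix.of fun i c => (A ^ (c.1 : ℕ) * B) i c.2

/-- The pair `(A, B)`, i.e. the system `x' = A x + B u`, is controllable. -/
def Controllable {ι κ : Type*} [Fintype ι] [DecidableEq ι] [Fintype κ]
    (A : Matrix ι ι ℝ) (B : Matrix ι κ ℝ) : Prop :=
  (controllabilityMatrix A B).rank = Fintype.card ι

/-- `A` is a numerical realization of the structured matrix `P`. -/
def IsRealization {ι κ : Type*} (P : Matrix ι κ Bool) (A : Matrix ι κ ℝ) : Prop :=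
  ∀ i j, P i j = false → A i j = 0

/-- The structured system `(P, Q)` has a controllable numerical realization. -/
def StructurallyControllable {ι κ : Type*} [Fintype ι] [DecidableEq ι] [Fintype κ]
    (P : Matrix ι ι Bool) (Q : Matrix ι κ Bool) : Prop :=
  ∃ (A : Matrix ι ι ℝ) (B : Matrix ι κ ℝ),
    IsRealization P A ∧ IsRealization Q B ∧ Controllable A B

/-- The number of `*` entries of a structured matrix. -/
def zeroNorm {ι κ : Type*} [Fintype ι] [Fintype κ] (P : Matrix ι κ Bool) : ℕ :=
  (Finset.univ.filter fun e : ι × κ => P e.1 e.2 = true).card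

/-! ### Composite systems -/

/-- The states of a composite system made of `k` subsystems with `n` states each;
`(i, p)` is the `p`-th state of the `i`-th subsystem. -/
abbrev State (k n : ℕ) : Type := Fin k × Fin n

/-- All possible interconnections: the pair `(x, y)` is the directed edge from the state `x` to
the state `y`, and `x`, `y` belong to different subsystems. -/
def allInterconnections (k n : ℕ) : Finset (State k n × State k n) :=
  Finset.univ.filter fun e => e.1.1 ≠ e.2.1

/-- The structured state matrix of the composite system: its diagonal blocks are `As`, and an
off-diagonal entry `(y, x)` is `*` exactly when the edge from `x` to `y` belongs to `I`. -/
def composite {k n : ℕ} (As : Matrix (Fin n) (Fin n) Bool)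
    (I : Finset (State k n × State k n)) : Matrix (State k n) (State k n) Bool :=
  Matrix.of fun y x => if y.1 = x.1 then As y.2 x.2 else decide ((x, y) ∈ I)

/-- The interconnections that are present in a structured composite state matrix. -/
def interconnections {k n : ℕ} (P : Matrix (State k n) (State k n) Bool) :
    Finset (State k n × State k n) :=
  (allInterconnections k n).filter fun e => P e.2 e.1 = true

/-- The feasible set: structured composite state matrices with diagonal blocks `As` that are
structurally controllable with the given input matrix. -/
def feasible {k n : ℕ} (As : Matrix (Fin n) (Fin n) Bool) (B : Matrix (State k n) (Fin 1) Bool) :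
    Set (Matrix (State k n) (State k n) Bool) :=
  {P | (∀ i p q, P (i, p) (i, q) = As p q) ∧ StructurallyControllable P B}

/-- `P` is an optimal solution of the minimum interconnection problem: a sparsest feasible
matrix. -/
def IsOptimalSolution {k n : ℕ} (As : Matrix (Fin n) (Fin n) Bool)
    (B : Matrix (State k n) (Fin 1) Bool) (P : Matrix (State k n) (State k n) Bool) : Prop :=
  P ∈ feasible As B ∧ ∀ P' ∈ feasible As B, zeroNorm P ≤ zeroNorm P'

/-! ### Digraphs, accessibility, strongly connected components -/

/-- Adjacency of the disjoint union of the state digraphs of the subsystems. -/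
def localAdj {k n : ℕ} (As : Matrix (Fin n) (Fin n) Bool) (x y : State k n) : Prop :=
  x.1 = y.1 ∧ As y.2 x.2 = true

/-- Adjacency of the digraph on the states and the input node which contains the edges inside the
subsystems, the input edges, and the interconnections in `F`. -/
def sysAdj {k n : ℕ} (As : Matrix (Fin n) (Fin n) Bool) (B : Matrix (State k n) (Fin 1) Bool)
    (F : Finset (State k n × State k n)) : State k n ⊕ Fin 1 → State k n ⊕ Fin 1 → Prop
  | .inl x, .inl y => localAdj As x y ∨ (x, y) ∈ F
  | .inr u, .inl y => B y u = true
  | _, .inr _ => False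

/-- The state `x` is accessible (using the interconnections in `F`): there is a path to it from
the input node. -/
def Accessible {k n : ℕ} (As : Matrix (Fin n) (Fin n) Bool) (B : Matrix (State k n) (Fin 1) Bool)
    (F : Finset (State k n × State k n)) (x : State k n) : Prop :=
  ∃ u : Fin 1, Relation.ReflTransGen (sysAdj As B F) (.inr u) (.inl x)

/-- A set of states is accessible if all its states are. -/
def SetAccessible {k n : ℕ} (As : Matrix (Fin n) (Fin n) Bool)
    (B : Matrix (State k n) (Fin 1) Bool) (F : Finset (State k n × State k n))
    (S : Finset (State k n)) : Prop :=
  ∀ x ∈ S, Accessible As B F x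

/-- `S` is (the vertex set of) a strongly connected component of the digraph `adj`: a class of
mutually reachable vertices. -/
def IsSCC {V : Type*} (adj : V → V → Prop) (S : Finset V) : Prop :=
  ∃ x, ∀ y, y ∈ S ↔ Relation.ReflTransGen adj x y ∧ Relation.ReflTransGen adj y x

/-- No edge enters `S` from outside. -/
def NonTopLinked {V : Type*} (adj : V → V → Prop) (S : Finset V) : Prop :=
  ∀ x y, x ∉ S → y ∈ S → ¬ adj x y

open Classical in
/-- The non-top linked strongly connected components of the subsystems that are not accessible
when no interconnection is present. (A component of the disjoint union of the subsystem digraphs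
is a component of one of them.) -/
noncomputable def inaccessibleSCCs {k n : ℕ} (As : Matrix (Fin n) (Fin n) Bool)
    (B : Matrix (State k n) (Fin 1) Bool) : Finset (Finset (State k n)) :=
  Finset.univ.filter fun S =>
    IsSCC (localAdj As) S ∧ NonTopLinked (localAdj As) S ∧ ¬ SetAccessible As B ∅ S

/-! ### Bipartite graphs and matchings -/

/-- A bipartite graph with vertices taken from `L` and `R`. -/
structure BipGraph (L R : Type*) where
  left : Finset L
  right : Finset R
  edges : Finset (L × R)
  edges_subset : edges ⊆ left ×ˢ right

namespace BipGraph

variable {L R : Type*} [DecidableEq L] [DecidableEq R]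

/-- `M` is a matching of `G`: distinct edges of `M` have distinct left and right endpoints. -/
def IsMatching (G : BipGraph L R) (M : Finset (L × R)) : Prop :=
  M ⊆ G.edges ∧ ∀ e ∈ M, ∀ f ∈ M, e ≠ f → e.1 ≠ f.1 ∧ e.2 ≠ f.2

/-- A matching whose size is the size of the smaller side. -/
def IsPerfectMatching (G : BipGraph L R) (M : Finset (L × R)) : Prop :=
  G.IsMatching M ∧ M.card = min G.left.card G.right.card

/-- A perfect matching of minimum cost. -/
def IsMinCostPerfectMatching (G : BipGraph L R) (c : L × R → ℕ) (M : Finset (L × R)) : Prop :=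
  G.IsPerfectMatching M ∧ ∀ M', G.IsPerfectMatching M' → ∑ e ∈ M, c e ≤ ∑ e ∈ M', c e

/-- The difference of `G` and `M`: all nodes covered by `M` are removed, together with the edges at
these nodes. -/
def minus (G : BipGraph L R) (M : Finset (L × R)) : BipGraph L R where
  left := G.left \ M.image Prod.fst
  right := G.right \ M.image Prod.snd
  edges := G.edges.filter fun e => e.1 ∉ M.image Prod.fst ∧ e.2 ∉ M.image Prod.snd
  edges_subset := by
    intro e he
    rw [Finset.mem_filter] at he
    have h := Finset.mem_product.1 (G.edges_subset he.1)
    exact Finset.mem_product.2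
      ⟨Finset.mem_sdiff.2 ⟨h.1, he.2.1⟩, Finset.mem_sdiff.2 ⟨h.2, he.2.2⟩⟩

end BipGraph

/-- The right-hand nodes of the bipartite graphs: states, the input, and condensed strongly
connected components. The left-hand nodes are (copies `x'` of) states. -/
inductive RightNode (k n : ℕ) : Type
  | state (x : State k n)
  | input (u : Fin 1)
  | scc (S : Finset (State k n))
  deriving DecidableEq

/-- An edge of the bipartite graphs; `(y, state x)` corresponds to the directed edge `x → y`. -/
abbrev Edge (k n : ℕ) : Type := State k n × RightNode k n

/-- Bipartite edges inside the subsystems. -/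
def edgesX {k n : ℕ} (As : Matrix (Fin n) (Fin n) Bool) : Finset (Edge k n) :=
  (Finset.univ.filter fun e : State k n × State k n =>
    e.1.1 = e.2.1 ∧ As e.1.2 e.2.2 = true).image fun e => (e.1, .state e.2)

/-- Bipartite edges given by interconnections. -/
def edgesI (k n : ℕ) : Finset (Edge k n) :=
  (Finset.univ.filter fun e : State k n × State k n => e.1.1 ≠ e.2.1).image
    fun e => (e.1, .state e.2)

/-- Bipartite edges at the input node. -/
def edgesU {k n : ℕ} (B : Matrix (State k n) (Fin 1) Bool) : Finset (Edge k n) :=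
  (Finset.univ.filter fun e : State k n × Fin 1 => B e.1 e.2 = true).image
    fun e => (e.1, .input e.2)

/-- Bipartite edges joining a state to the component in `inaccessibleSCCs` that contains it. -/
noncomputable def edgesN {k n : ℕ} (As : Matrix (Fin n) (Fin n) Bool)
    (B : Matrix (State k n) (Fin 1) Bool) : Finset (Edge k n) :=
  ((Finset.univ ×ˢ inaccessibleSCCs As B).filter
    fun e : State k n × Finset (State k n) => e.1 ∈ e.2).image fun e => (e.1, .scc e.2)

/-- The right-hand nodes that are states or the input. -/
def systemNodes (k n : ℕ) : Finset (RightNode k n) :=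
  Finset.univ.image RightNode.state ∪ Finset.univ.image RightNode.input

/-- The system bipartite graph of the composite system with all possible interconnections. -/
def bipAB {k n : ℕ} (As : Matrix (Fin n) (Fin n) Bool) (B : Matrix (State k n) (Fin 1) Bool) :
    BipGraph (State k n) (RightNode k n) where
  left := Finset.univ
  right := systemNodes k n
  edges := edgesX As ∪ edgesI k n ∪ edgesU B
  edges_subset := by
    intro e he
    simp only [edgesX, edgesI, edgesU, Finset.mem_union, Finset.mem_image] at he
    simp only [systemNodes, Finset.mem_product, Finset.mem_union, Finset.mem_image,
      Finset.mem_univ, true_and]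
    rcases he with (⟨a, _, rfl⟩ | ⟨a, _, rfl⟩) | ⟨a, _, rfl⟩
    · exact Or.inl ⟨_, rfl⟩
    · exact Or.inl ⟨_, rfl⟩
    · exact Or.inr ⟨_, rfl⟩

/-- The system bipartite graph enlarged by one right-hand node for each component in
`inaccessibleSCCs`. -/
noncomputable def bipABN {k n : ℕ} (As : Matrix (Fin n) (Fin n) Bool)
    (B : Matrix (State k n) (Fin 1) Bool) : BipGraph (State k n) (RightNode k n) where
  left := Finset.univ
  right := systemNodes k n ∪ (inaccessibleSCCs As B).image RightNode.scc
  edges := edgesX As ∪ edgesI k n ∪ edgesU B ∪ edgesN As B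
  edges_subset := by
    intro e he
    rcases Finset.mem_union.1 he with h | h
    · have h' := Finset.mem_product.1 ((bipAB As B).edges_subset h)
      exact Finset.mem_product.2 ⟨h'.1, Finset.mem_union_left _ h'.2⟩
    · simp only [edgesN, Finset.mem_image, Finset.mem_filter, Finset.mem_product] at h
      obtain ⟨a, ha, rfl⟩ := h
      exact Finset.mem_product.2 ⟨Finset.mem_univ _, Finset.mem_union_right _
        (Finset.mem_image_of_mem _ ha.1.2)⟩

/-- The cost function: `0` on input edges, `1` inside subsystems, `2` on edges to components,
`3` on interconnections. -/
def cost {k n : ℕ} (e : Edge k n) : ℕ :=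
  match e.2 with
  | .input _ => 0
  | .state x => if e.1.1 = x.1 then 1 else 3
  | .scc _ => 2

/-- `M` is an optimum matching of the enlarged bipartite graph. -/
def IsOptimumMatching {k n : ℕ} (As : Matrix (Fin n) (Fin n) Bool)
    (B : Matrix (State k n) (Fin 1) Bool) (M : Finset (Edge k n)) : Prop :=
  (bipABN As B).IsMinCostPerfectMatching cost M

/-! ### The algorithm -/

/-- The interconnections (as directed edges) that are used by a matching. -/
def usedLinks {k n : ℕ} (M : Finset (Edge k n)) : Finset (State k n × State k n) :=
  (allInterconnections k n).filter fun e => (e.2, RightNode.state e.1) ∈ M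

/-- `y` lies in a component in `inaccessibleSCCs` that is still inaccessible when the
interconnections of `M` are used, although `y` is matched in `M` by an interconnection. -/
def ToRepair {k n : ℕ} (As : Matrix (Fin n) (Fin n) Bool) (B : Matrix (State k n) (Fin 1) Bool)
    (M : Finset (Edge k n)) (y : State k n) : Prop :=
  (∃ x : State k n, x.1 ≠ y.1 ∧ (y, RightNode.state x) ∈ M) ∧
    ∃ S ∈ inaccessibleSCCs As B, y ∈ S ∧ ¬ SetAccessible As B (usedLinks M) S

/-- `r` is a right-unmatched node of `M` that is accessible using the interconnections of `M`. -/
def UnmatchedAccessible {k n : ℕ} (As : Matrix (Fin n) (Fin n) Bool)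
    (B : Matrix (State k n) (Fin 1) Bool) (M : Finset (Edge k n)) (r : State k n) : Prop :=
  (∀ y, (y, RightNode.state r) ∉ M) ∧ Accessible As B (usedLinks M) r

/-- The body of the repair loop, for a node `y` to be repaired: with `r` unmatched and accessible,
and `(y, x)` the edge of the matching at `y`,
* if `y` and `r` are in different subsystems, then `(y, x)` is replaced by `(y, r)`;
* if they are in the same subsystem, then an interconnection edge `(s, z)` of the matching, with
  `s` in the subsystem of `x`, is replaced by `(s, r)`. -/
def Repair {k n : ℕ} (As : Matrix (Fin n) (Fin n) Bool) (B : Matrix (State k n) (Fin 1) Bool)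
    (M : Finset (Edge k n)) (y : State k n) (M' : Finset (Edge k n)) : Prop :=
  ∃ r x : State k n, UnmatchedAccessible As B M r ∧ (y, RightNode.state x) ∈ M ∧
    ((y.1 ≠ r.1 ∧ M' = insert (y, RightNode.state r) (M.erase (y, RightNode.state x))) ∨
      (y.1 = r.1 ∧ ∃ s z : State k n, s.1 = x.1 ∧ z.1 ≠ s.1 ∧ (s, RightNode.state z) ∈ M ∧
        M' = insert (s, RightNode.state r) (M.erase (s, RightNode.state z))))

/-- Addition of one extra interconnection to `F`: it leads from an accessible state into a
component in `inaccessibleSCCs`, of another subsystem, that is not yet accessible. -/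
def AddLink {k n : ℕ} (As : Matrix (Fin n) (Fin n) Bool) (B : Matrix (State k n) (Fin 1) Bool)
    (M : Finset (Edge k n)) (F F' : Finset (State k n × State k n)) : Prop :=
  ∃ S ∈ inaccessibleSCCs As B, ¬ SetAccessible As B (usedLinks M ∪ F) S ∧
    ∃ y ∈ S, ∃ x, Accessible As B (usedLinks M ∪ F) x ∧ x.1 ≠ y.1 ∧ F' = insert (x, y) F

/-- The states through which an execution of the algorithm passes. -/
inductive AlgState (k n : ℕ) : Type
  /-- Initial state. -/
  | start
  /-- An optimum matching of the enlarged bipartite graph has been found. -/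
  | optimum (M : Finset (Edge k n))
  /-- Head of the repair loop, with the current matching. -/
  | loop (M : Finset (Edge k n))
  /-- Inside the repair loop, a node to be repaired having been selected. -/
  | selected (M : Finset (Edge k n)) (y : State k n)
  /-- The repair loop has been left; `F` is the set of extra interconnections added so far. -/
  | adding (M : Finset (Edge k n)) (F : Finset (State k n × State k n))
  /-- Termination, with output `I`. -/
  | done (I : Finset (State k n × State k n))

/-- One step of the algorithm. All selections are nondeterministic. The predicate `ok y M'` is a
restriction on the matchings `M'` that may be chosen when the node `y` is repaired. -/
inductive Step {k n : ℕ} (As : Matrix (Fin n) (Fin n) Bool) (B : Matrix (State k n) (Fin 1) Bool)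
    (ok : State k n → Finset (Edge k n) → Prop) : AlgState k n → AlgState k n → Prop
  | findOptimum (M : Finset (Edge k n)) (hM : IsOptimumMatching As B M) :
      Step As B ok .start (.optimum M)
  | complete (M M'' : Finset (Edge k n))
      (hM : ((bipAB As B).minus (M ∩ (edgesX As ∪ edgesU B))).IsPerfectMatching M'') :
      Step As B ok (.optimum M) (.loop (M ∩ (edgesX As ∪ edgesU B) ∪ M''))
  | select (M : Finset (Edge k n)) (y : State k n) (hy : ToRepair As B M y) :
      Step As B ok (.loop M) (.selected M y)
  | repair (M : Finset (Edge k n)) (y : State k n) (M' : Finset (Edge k n))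
      (hM : Repair As B M y M') (hok : ok y M') :
      Step As B ok (.selected M y) (.loop M')
  | leave (M : Finset (Edge k n)) (hM : ∀ y, ¬ ToRepair As B M y) :
      Step As B ok (.loop M) (.adding M ∅)
  | add (M : Finset (Edge k n)) (F F' : Finset (State k n × State k n))
      (hF : AddLink As B M F F') :
      Step As B ok (.adding M F) (.adding M F')
  | output (M : Finset (Edge k n)) (F : Finset (State k n × State k n))
      (hF : ∀ S ∈ inaccessibleSCCs As B, SetAccessible As B (usedLinks M ∪ F) S) :
      Step As B ok (.adding M F) (.done (usedLinks M ∪ F))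

/-- `s` is reached by some execution of the algorithm (with repairs restricted by `ok`). -/
def Reachable {k n : ℕ} (As : Matrix (Fin n) (Fin n) Bool) (B : Matrix (State k n) (Fin 1) Bool)
    (ok : State k n → Finset (Edge k n) → Prop) (s : AlgState k n) : Prop :=
  Relation.ReflTransGen (Step As B ok) .start s

/-- No restriction on the repairs. -/
def AnyRepair {k n : ℕ} (_ : State k n) (_ : Finset (Edge k n)) : Prop := True

/-- The repair of `y` makes the component of `y` accessible. -/
def EffectiveRepair {k n : ℕ} (As : Matrix (Fin n) (Fin n) Bool)
    (B : Matrix (State k n) (Fin 1) Bool) (y : State k n) (M' : Finset (Edge k n)) : Prop :=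
  ∀ S ∈ inaccessibleSCCs As B, y ∈ S → SetAccessible As B (usedLinks M') S

end StructComposite

-- Structural controllability with one input amounts to two combinatorial conditions: every state is
-- accessible from `u`, and the rows of `[A B]` can be matched to distinct columns through `*`
-- entries. Necessity is linear algebra: the unit vector of an inaccessible state annihilates all `A
-- ^ i * B` (`StructurallyControllable.reach`), and the rows of `[A B]` are linearly independent, so
-- Hall's condition holds (`StructurallyControllable.exists_matching`). For sufficiency a matching
-- splits the states into a (possibly trivial) path from `u` and disjoint cycles. The cycles are
-- attached one at a time by edges of the digraph, each with a weight for which no left eigenvector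
-- vanishing at `u` appears (`EigTest.extend`).
--
-- Write X, U, I, N for the edge classes. By `sum_cost_add`, a perfect matching has minimum cost
-- exactly when the sum of its numbers of non-I edges, of X ∪ U edges and of U edges is largest. The
-- Mendelsohn–Dulmage theorem, together with a completion by interconnections that relies on all
-- subsystems being copies of each other, yields one perfect matching attaining all three maxima
-- (`exists_best_matching`). Hence every optimum matching attains each of them, and its non-I part
-- has `k * n - β` edges.
--
-- Lower bound: let `F` be feasible, with matching `M`. Each member of 𝒩 entered by a link of `M`
-- can take over the left endpoint of such a link, so |M ∩ (X ∪ U)| plus the number of entered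
-- members is at most `k * n - β`. Each member not entered by `M` costs a further link of `F`.
-- Together, |F| ≥ β + q. The algorithm attains equality: its matching always keeps the X ∪ U part
-- of the optimum matching, its links enter at least the members that the optimum matching covers,
-- and each link added at the end enters exactly one new member.
--
-- Progress rests on pigeonhole arguments for injective self-maps of finite sets, given by following
-- matching edges (`Extends.exists_unmatchedAccessible`, `Extends.exists_effectiveRepair`).
-- Termination holds because an effective repair loses no accessible state and gains one.

namespace StructComposite

/-! ### The Kalman criterion and left eigenvectors -/

section Kalman

open Matrix Polynomial

/-- Cayley–Hamilton: `X ^ m` is reduced modulo the characteristic polynomial. Nonemptiness keeps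
that polynomial different from 1, so that the remainder has `natDegree` strictly below the
dimension. -/
theorem pow_mem_span_pow {ι : Type*} [Fintype ι] [DecidableEq ι] [Nonempty ι]
    (A : Matrix ι ι ℝ) (m : ℕ) :
    ∃ c : ℕ → ℝ, A ^ m = ∑ i ∈ Finset.range (Fintype.card ι), c i • A ^ i := by
  refine ⟨(X ^ m %ₘ A.charpoly).coeff, ?_⟩
  rw [Matrix.pow_eq_aeval_mod_charpoly]
  apply Polynomial.aeval_eq_sum_range'
  have h := Polynomial.natDegree_modByMonic_lt (X ^ m) A.charpoly_monic (fun h => by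
    have := A.charpoly_natDegree_eq_dim
    rw [h] at this
    exact Fintype.card_ne_zero (α := ι) (by simpa using this.symm))
  rwa [A.charpoly_natDegree_eq_dim] at h

/-- Full rank means independent rows, i.e. injectivity of `v ↦ v ᵥ* controllabilityMatrix A B`.
Cayley–Hamilton removes the bound on the exponent. -/
theorem controllable_iff {ι κ : Type*} [Fintype ι] [DecidableEq ι] [Fintype κ]
    (A : Matrix ι ι ℝ) (B : Matrix ι κ ℝ) :
    Controllable A B ↔ ∀ v : ι → ℝ, (∀ i : ℕ, v ᵥ* (A ^ i * B) = 0) → v = 0 := by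
  unfold Controllable
  rw [Matrix.rank_eq_finrank_span_row, eq_comm]
  have h1 := linearIndependent_iff_card_eq_finrank_span (R := ℝ)
    (b := (controllabilityMatrix A B).row)
  unfold Set.finrank at h1
  rw [← h1, ← Matrix.vecMul_injective_iff]
  have key : ∀ v : ι → ℝ, v ᵥ* controllabilityMatrix A B = 0 ↔
      ∀ i : ℕ, v ᵥ* (A ^ i * B) = 0 := by
    intro v
    rcases isEmpty_or_nonempty ι with hι | hι
    · constructor
      · intro _ i
        ext j
        simp [Matrix.vecMul, dotProduct]
      · intro _
        ext j
        simp [Matrix.vecMul, dotProduct]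
    constructor
    · intro h
      have h' : ∀ i < Fintype.card ι, v ᵥ* (A ^ i * B) = 0 := by
        intro i hi
        ext j
        have := congrFun h (⟨i, hi⟩, j)
        simpa [controllabilityMatrix, Matrix.vecMul, dotProduct] using this
      intro m
      obtain ⟨c, hc⟩ := pow_mem_span_pow A m
      rw [hc, Matrix.sum_mul, Matrix.vecMul_sum]
      refine Finset.sum_eq_zero fun i hi => ?_
      rw [Matrix.smul_mul, Matrix.vecMul_smul, h' i (Finset.mem_range.1 hi), smul_zero]
    · intro h
      ext ⟨i, j⟩
      have := congrFun (h i) j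
      simpa [controllabilityMatrix, Matrix.vecMul, dotProduct] using this
  constructor
  · intro h v hv
    exact h (by simpa using (key v).2 hv)
  · intro h v w hvw
    have : (v - w) = 0 := h _ ((key _).1 (by rw [Matrix.sub_vecMul]; exact sub_eq_zero.2 hvw))
    exact sub_eq_zero.1 this

theorem exists_left_eigenvector {W : Type*} [Fintype W] (A : Matrix W W ℂ) (Z : Submodule ℂ (W → ℂ))
    (hZ : ∀ v ∈ Z, v ᵥ* A ∈ Z) (hne : Z ≠ ⊥) :
    ∃ v ∈ Z, v ≠ 0 ∧ ∃ c : ℂ, v ᵥ* A = c • v := by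
  have : Nontrivial Z := Submodule.nontrivial_iff_ne_bot.2 hne
  obtain ⟨c, hc⟩ := Module.End.exists_eigenvalue
    ((Matrix.vecMulLinear A).restrict (p := Z) (q := Z) (fun v hv => hZ v hv))
  obtain ⟨v, hv⟩ := hc.exists_hasEigenvector
  refine ⟨v, v.2, fun h => hv.2 (Subtype.ext h), c, ?_⟩
  exact congrArg Subtype.val hv.apply_eq_smul

variable {W : Type*} [Fintype W] [DecidableEq W]

/-- No left eigenvector of `A` supported on `T` vanishes at `u`. -/
def EigTest (A : Matrix W W ℂ) (u : W) (T : Set W) : Prop :=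
  ∀ (c : ℂ) (v : W → ℂ), (∀ y, y ∉ T → v y = 0) → v ᵥ* A = c • v → v u = 0 → v = 0

/-- The eigenvector test in the direction needed here: the vectors supported on `T` that annihilate
column `u` of all powers form a subspace stable under `ᵥ* A`. Were it nonzero, it would contain a
left eigenvector, which the test forbids. The columns of `A` off `T` vanish, which keeps supports
inside `T`. -/
theorem EigTest.eq_zero {A : Matrix W W ℂ} {u : W} {T : Set W} (h : EigTest A u T)
    (hA : ∀ y x, A y x ≠ 0 → x ∈ T) (v : W → ℂ) (hv : ∀ y, y ∉ T → v y = 0)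
    (hu : ∀ i : ℕ, (v ᵥ* A ^ i) u = 0) : v = 0 := by
  let Z : Submodule ℂ (W → ℂ) :=
    { carrier := {v | (∀ y, y ∉ T → v y = 0) ∧ ∀ i : ℕ, (v ᵥ* A ^ i) u = 0}
      add_mem' := fun {a b} ha hb => ⟨fun y hy => by simp [ha.1 y hy, hb.1 y hy], fun i => by
        rw [Matrix.add_vecMul, Pi.add_apply, ha.2, hb.2, add_zero]⟩
      zero_mem' := ⟨fun _ _ => rfl, fun i => by simp⟩
      smul_mem' := fun c a ha => ⟨fun y hy => by simp [ha.1 y hy], fun i => by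
        rw [Matrix.smul_vecMul, Pi.smul_apply, ha.2, smul_zero]⟩ }
  by_contra hne
  have hbot : Z ≠ ⊥ := by
    intro hb
    have : v ∈ Z := ⟨hv, hu⟩
    rw [hb] at this
    exact hne ((Submodule.mem_bot ℂ).1 this)
  obtain ⟨w, hw, hw0, c, hc⟩ := exists_left_eigenvector A Z (by
    rintro a ⟨_, ha2⟩
    refine ⟨fun x hx => ?_, fun i => ?_⟩
    · refine Finset.sum_eq_zero fun y _ => ?_
      have : A y x = 0 := by
        by_contra h0
        exact hx (hA y x h0)
      simp [this]
    · rw [Matrix.vecMul_vecMul, ← pow_succ']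
      exact ha2 (i + 1)) hbot
  exact hw0 (h c w hw.1 hc (by simpa using hw.2 0))

/-- Over formal power series `1 - X A` has the inverse `∑ X ^ n A ^ n`, so its adjugate is this
series times a nonzero determinant. The entry at `(x, u)` is then nonzero as soon as one coefficient
`(A ^ n) x u` is. -/
theorem adjugate_one_sub_X_smul_ne_zero (A : Matrix W W ℂ) (x u : W)
    (h : ∃ i : ℕ, (A ^ i) x u ≠ 0) :
    (1 - (X : ℂ[X]) • A.map C).adjugate x u ≠ 0 := by
  obtain ⟨m, hm⟩ := h
  set M : Matrix W W ℂ[X] := 1 - (X : ℂ[X]) • A.map C with hM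
  let φ := Polynomial.coeToPowerSeries.ringHom (R := ℂ)
  let G : Matrix W W (PowerSeries ℂ) := Matrix.of fun i j => PowerSeries.mk fun n => (A ^ n) i j
  have hMG : φ.mapMatrix M * G = 1 := by
    have hφ : φ.mapMatrix M = 1 - (PowerSeries.X : PowerSeries ℂ) • A.map (PowerSeries.C) := by
      rw [hM, map_sub, map_one]
      congr 1
      ext i j : 2
      simp [φ]
      ring
    rw [hφ, sub_mul, one_mul]
    ext i j n
    rw [Matrix.sub_apply, Matrix.smul_mul, Matrix.smul_apply, Matrix.mul_apply]
    simp only [G, Matrix.of_apply, Matrix.map_apply, smul_eq_mul, map_sub, PowerSeries.coeff_mk]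
    cases n with
    | zero =>
      rw [pow_zero, PowerSeries.coeff_zero_X_mul, sub_zero]
      by_cases hij : i = j
      · subst hij; simp
      · simp [hij]
    | succ n =>
      rw [PowerSeries.coeff_succ_X_mul, map_sum, pow_succ', Matrix.mul_apply]
      simp only [PowerSeries.coeff_C_mul, PowerSeries.coeff_mk, sub_self]
      by_cases hij : i = j
      · subst hij; simp [PowerSeries.coeff_one]
      · simp [hij]
  have hadj : φ.mapMatrix M.adjugate = (φ.mapMatrix M).det • G := by
    rw [RingHom.map_adjugate]
    calc (φ.mapMatrix M).adjugate = (φ.mapMatrix M).adjugate * (φ.mapMatrix M * G) := by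
          rw [hMG, mul_one]
      _ = _ := by rw [← mul_assoc, Matrix.adjugate_mul, Matrix.smul_mul, one_mul]
  have hdet : (φ.mapMatrix M).det ≠ 0 := by
    intro h0
    have := congrArg Matrix.det hMG
    rw [Matrix.det_mul, h0, zero_mul, Matrix.det_one] at this
    exact zero_ne_one this
  intro h0
  have h1 := congrFun (congrFun hadj x) u
  rw [RingHom.mapMatrix_apply, Matrix.map_apply, h0, map_zero, Matrix.smul_apply, smul_eq_mul] at h1
  rcases mul_eq_zero.1 h1.symm with h2 | h2
  · exact hdet h2
  · have := congrArg (PowerSeries.coeff m) h2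
    simp only [G, Matrix.of_apply, PowerSeries.coeff_mk, map_zero] at this
    exact hm this

theorem eval_adjugate_one_sub_X_smul (A : Matrix W W ℂ) (x u : W) (t : ℂ) :
    ((1 - (X : ℂ[X]) • A.map C).adjugate x u).eval t = (1 - t • A).adjugate x u := by
  have h := RingHom.map_adjugate (Polynomial.evalRingHom t) (1 - (X : ℂ[X]) • A.map C)
  have h2 : (Polynomial.evalRingHom t).mapMatrix (1 - (X : ℂ[X]) • A.map C) = 1 - t • A := by
    rw [map_sub, map_one]
    congr 1
    ext i j
    simp
    ring
  rw [h2] at h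
  exact congrFun (congrFun h x) u

end Kalman

/-! ### Realizations built from a stem and disjoint cycles -/

section Cactus

set_option linter.unusedSectionVars false

open Matrix Polynomial

variable {W : Type*} [Fintype W] [DecidableEq W]

/-- The roots have finitely many norms. The inverse appears because the polynomial will be evaluated
at `l⁻¹` for an eigenvalue `l` of norm `w`. -/
theorem exists_pos_norm_avoiding (p : ℂ[X]) (hp : p ≠ 0) :
    ∃ w : ℝ, 0 < w ∧ ∀ t : ℂ, ‖t‖ = w⁻¹ → p.eval t ≠ 0 := by
  have hfin : ((fun t : ℂ => ‖t‖) '' {t | p.IsRoot t}).Finite :=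
    (Polynomial.finite_setOfPred_isRoot hp).image _
  obtain ⟨r, hr, hr'⟩ := (Set.Ioi_infinite (0 : ℝ)).exists_notMem_finite hfin
  refine ⟨r⁻¹, inv_pos.2 hr, fun t ht h0 => hr' ⟨t, h0, ?_⟩⟩
  simpa using ht

/-- The forward orbit of `c` under `σ`. -/
def orbit (σ : W → W) (c : W) : Set W := {y | ∃ m : ℕ, σ^[m] c = y}

theorem orbit_apply {σ : W → W} {c y : W} (hy : y ∈ orbit σ c) : σ y ∈ orbit σ c := by
  obtain ⟨m, rfl⟩ := hy
  exact ⟨m + 1, Function.iterate_succ_apply' σ m c⟩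

theorem orbit_disjoint {σ : W → W} {c u : W} {T : Set W} (huT : u ∈ T)
    (hcl : ∀ y, y ≠ u → (σ y ∈ T ↔ y ∈ T)) (hc : c ∉ T) {y : W} (hy : y ∈ orbit σ c) :
    y ∉ T := by
  obtain ⟨m, rfl⟩ := hy
  induction m with
  | zero => exact hc
  | succ m ih =>
    rw [Function.iterate_succ_apply']
    rwa [hcl _ (fun h => ih (by rw [h]; exact huT))]

open Classical in
theorem sum_orbit_apply {σ : W → W} {c : W} (hinj : Set.InjOn σ (orbit σ c)) (f : W → ℝ) :
    ∑ y ∈ Finset.univ.filter (· ∈ orbit σ c), f (σ y) =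
      ∑ y ∈ Finset.univ.filter (· ∈ orbit σ c), f y := by
  set S := Finset.univ.filter (· ∈ orbit σ c) with hS
  have hSinj : Set.InjOn σ S := fun a ha b hb h =>
    hinj (by simpa [hS] using ha) (by simpa [hS] using hb) h
  have himg : S.image σ = S := by
    apply Finset.eq_of_subset_of_card_le
    · intro z hz
      obtain ⟨y, hy, rfl⟩ := Finset.mem_image.1 hz
      simp only [hS, Finset.mem_filter, Finset.mem_univ, true_and] at hy ⊢
      exact orbit_apply hy
    · rw [Finset.card_image_of_injOn hSinj]
  rw [← Finset.sum_image (f := f) hSinj, himg]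

/-- Restores the invariance of `T` under `σ` and its preimages after a cycle has been adjoined.
Injectivity makes `σ` a permutation of the finite orbit, so a preimage of an orbit point lies in the
orbit. -/
theorem orbit_closed {σ : W → W} {c u : W} {T : Set W} (huT : u ∈ T)
    (hσ : Set.InjOn σ {y | y ≠ u}) (hcl : ∀ y, y ≠ u → (σ y ∈ T ↔ y ∈ T)) (hc : c ∉ T) :
    ∀ y, y ≠ u → (σ y ∈ T ∪ orbit σ c ↔ y ∈ T ∪ orbit σ c) := by
  classical
  have hdis := fun {y} => orbit_disjoint (y := y) huT hcl hc
  have hne : ∀ {y}, y ∈ orbit σ c → y ≠ u := fun hy h => hdis hy (h ▸ huT)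
  intro y hy
  constructor
  · rintro (h | h)
    · exact Or.inl ((hcl y hy).1 h)
    · right
      set S := Finset.univ.filter (· ∈ orbit σ c) with hS
      have hmaps : ∀ a ∈ S, σ a ∈ S := fun a ha => by
        simp only [hS, Finset.mem_filter, Finset.mem_univ, true_and] at ha ⊢
        exact orbit_apply ha
      have hsurj := Finset.surj_on_of_inj_on_of_card_le (s := S) (t := S) (fun a _ => σ a) hmaps
        (fun a b ha hb hab => hσ (hne (by simpa [hS] using ha)) (hne (by simpa [hS] using hb)) hab)
        le_rfl
      obtain ⟨a, ha, hab⟩ := hsurj (σ y) (by simpa [hS] using h)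
      have ha' : a ∈ orbit σ c := by simpa [hS] using ha
      rwa [hσ hy (hne ha') hab]
  · rintro (h | h)
    · exact Or.inl ((hcl y hy).2 h)
    · exact Or.inr (orbit_apply h)

open Classical in
/-- The cycle through `c`, with weight `w` on all its edges, and an edge of weight one from `x`
to `c`. -/
noncomputable def cycleMatrix (σ : W → W) (c x : W) (w : ℝ) : Matrix W W ℝ :=
  Matrix.of fun y z => (if y ∈ orbit σ c ∧ σ y = z then w else 0) + if y = c ∧ z = x then 1 else 0

/-- Let `v` be a left eigenvector for `l` with `v u = 0`. If `v c ≠ 0`, the cycle equations force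
`‖l‖ = w`, while the equations on `T` say that `v` solves a resolvent equation with right-hand side
a multiple of the unit vector at `x`. Its `u`-coordinate is a nonzero multiple of the `(x, u)` entry
of the adjugate of `1 - l⁻¹ A`, and `w` is chosen so that this entry does not vanish on the circle
in question. So `v c = 0`, then `v` vanishes on the whole cycle, and the test for `T` applies. -/
theorem EigTest.extend {A : Matrix W W ℝ} {u : W} {T : Set W}
    (hT : EigTest (A.map Complex.ofReal) u T) (hA : ∀ y x, A y x ≠ 0 → y ∈ T ∧ x ∈ T)
    (σ : W → W) (hσ : Set.InjOn σ {y | y ≠ u}) (huT : u ∈ T)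
    (hcl : ∀ y, y ≠ u → (σ y ∈ T ↔ y ∈ T)) {x c : W} (hx : x ∈ T) (hc : c ∉ T) :
    ∃ w : ℝ, EigTest ((A + cycleMatrix σ c x w).map Complex.ofReal) u (T ∪ orbit σ c) := by
  classical
  have hdis := fun {y} => orbit_disjoint (y := y) huT hcl hc
  have hne : ∀ {y}, y ∈ orbit σ c → y ≠ u := fun hy h => hdis hy (h ▸ huT)
  have hcc : c ∈ orbit σ c := ⟨0, rfl⟩
  set Ac := A.map Complex.ofReal with hAc
  have hAc0 : ∀ y z, z ∉ T → Ac y z = 0 := by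
    intro y z hz
    by_contra h
    exact hz (hA y z (by simpa [hAc] using h)).2
  -- Otherwise the unit vector at `x`, supported on `T`, would annihilate column `u` of all powers.
  have hreach : ∃ i : ℕ, (Ac ^ i) x u ≠ 0 := by
    by_contra! h
    have := hT.eq_zero (fun y z h => by by_contra hz; exact h (hAc0 y z hz)) (Pi.single x 1)
      (fun y hy => by
        rw [Pi.single_apply, if_neg]
        rintro rfl
        exact hy hx)
      (fun i => by rw [Matrix.single_one_vecMul]; exact h i)
    have := congrFun this x
    simp at this
  obtain ⟨w, hw, hwp⟩ := exists_pos_norm_avoiding _ (adjugate_one_sub_X_smul_ne_zero Ac x u hreach)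
  refine ⟨w, fun l v hv hvA hvu => ?_⟩
  have hvA' : ∀ z, l * v z = (v ᵥ* Ac) z +
      (∑ y, if y ∈ orbit σ c ∧ σ y = z then v y * w else 0) + if z = x then v c else 0 := by
    intro z
    have h := congrFun hvA z
    rw [Pi.smul_apply, smul_eq_mul] at h
    rw [← h]
    simp only [Matrix.vecMul, dotProduct, hAc, Matrix.map_apply, Matrix.add_apply, cycleMatrix,
      Matrix.of_apply, Complex.ofReal_add, mul_add, Finset.sum_add_distrib, add_assoc]
    congr 2
    · refine Finset.sum_congr rfl fun y _ => ?_
      split_ifs <;> simp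
    · by_cases hzx : z = x
      · rw [if_pos hzx, Finset.sum_eq_single c]
        · simp [hzx]
        · intro b _ hb
          simp [hb]
        · simp
      · simp [hzx]
  have h1 : ∀ z ∈ T, l * v z = (v ᵥ* Ac) z + if z = x then v c else 0 := by
    intro z hz
    rw [hvA' z, Finset.sum_eq_zero, add_zero]
    intro y _
    rw [if_neg]
    rintro ⟨hy, rfl⟩
    exact hdis (orbit_apply hy) hz
  have hvAc : ∀ z, z ∉ T → (v ᵥ* Ac) z = 0 := fun z hz =>
    Finset.sum_eq_zero fun y _ => mul_eq_zero_of_right _ (hAc0 y z hz)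
  have h2 : ∀ y ∈ orbit σ c, l * v (σ y) = v y * w := by
    intro y hy
    have hσy : σ y ∉ T := hdis (orbit_apply hy)
    rw [hvA' (σ y), hvAc _ hσy, if_neg (fun h : σ y = x => hσy (h ▸ hx)), zero_add, add_zero,
      Finset.sum_eq_single y]
    · rw [if_pos ⟨hy, rfl⟩]
    · intro b _ hb
      rw [if_neg]
      rintro ⟨h3, h4⟩
      exact hb (hσ (hne h3) (hne hy) h4)
    · simp
  have hvc : v c = 0 := by
    by_contra hvc
    have hsum := sum_orbit_apply (σ := σ) (c := c)
      (fun a ha b hb h => hσ (hne ha) (hne hb) h) (fun y => ‖v y‖)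
    have hpos : 0 < ∑ y ∈ Finset.univ.filter (· ∈ orbit σ c), ‖v y‖ :=
      Finset.sum_pos' (fun _ _ => norm_nonneg _) ⟨c, by simpa using hcc, by simpa using hvc⟩
    -- Sum the norms of the cycle equations: `σ` permutes the orbit, so both sides contain the same
    -- positive sum.
    have hnorm : ‖l‖ = w := by
      have h3 : ‖l‖ * ∑ y ∈ Finset.univ.filter (· ∈ orbit σ c), ‖v (σ y)‖ =
          w * ∑ y ∈ Finset.univ.filter (· ∈ orbit σ c), ‖v y‖ := by
        rw [Finset.mul_sum, Finset.mul_sum]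
        refine Finset.sum_congr rfl fun y hy => ?_
        have := congrArg norm (h2 y (by simpa using hy))
        rw [norm_mul, norm_mul, Complex.norm_real, Real.norm_of_nonneg hw.le] at this
        rw [this, mul_comm]
      rw [hsum] at h3
      exact mul_right_cancel₀ hpos.ne' h3
    have hl : l ≠ 0 := by
      rintro rfl
      rw [norm_zero] at hnorm
      exact hw.ne hnorm
    have hpt := hwp l⁻¹ (by rw [norm_inv, hnorm])
    rw [eval_adjugate_one_sub_X_smul] at hpt
    -- Only the part of `v` on `T` enters `v ᵥ* Ac`, since the rows of `Ac` off `T` are zero.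
    set v₀ : W → ℂ := fun y => if y ∈ T then v y else 0 with hv₀
    have hv₀A : v₀ ᵥ* Ac = v ᵥ* Ac := by
      ext z
      refine Finset.sum_congr rfl fun y _ => ?_
      by_cases hy : y ∈ T
      · simp [hv₀, hy]
      · have : Ac y z = 0 := by
          by_contra h
          exact hy (hA y z (by simpa [hAc] using h)).1
        simp [this]
    have h4 : v₀ ᵥ* (1 - l⁻¹ • Ac) = (l⁻¹ * v c) • Pi.single x 1 := by
      ext z
      rw [Matrix.vecMul_sub, Matrix.vecMul_one, Matrix.vecMul_smul, hv₀A, Pi.sub_apply,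
        Pi.smul_apply, Pi.smul_apply, smul_eq_mul, smul_eq_mul, Pi.single_apply]
      by_cases hz : z ∈ T
      · have h5 := h1 z hz
        have h6 : v z = l⁻¹ * ((v ᵥ* Ac) z + if z = x then v c else 0) := by
          rw [← h5]; field_simp
        simp only [hv₀, hz, if_true]
        rw [h6]
        split_ifs <;> ring
      · have hzx : z ≠ x := fun h => hz (h ▸ hx)
        simp [hv₀, hz, hvAc z hz, hzx]
    have h5 : v₀ ᵥ* ((1 - l⁻¹ • Ac) * (1 - l⁻¹ • Ac).adjugate) =
        ((l⁻¹ * v c) • Pi.single x 1) ᵥ* (1 - l⁻¹ • Ac).adjugate := by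
      rw [← h4, Matrix.vecMul_vecMul]
    rw [Matrix.mul_adjugate, Matrix.vecMul_smul, Matrix.vecMul_one, Matrix.smul_vecMul,
      Matrix.single_one_vecMul] at h5
    have h6 := congrFun h5 u
    simp only [Pi.smul_apply, smul_eq_mul, hv₀, huT, if_true, hvu, mul_zero, Matrix.row_apply]
      at h6
    exact mul_ne_zero (mul_ne_zero (inv_ne_zero hl) hvc) hpt h6.symm
  -- For `l = 0` the cycle equations give the zeros at once, as `w ≠ 0`; otherwise they carry the
  -- zero at `c` along `σ`.
  have hvC : ∀ y ∈ orbit σ c, v y = 0 := by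
    by_cases hl : l = 0
    · intro y hy
      have := h2 y hy
      rw [hl, zero_mul] at this
      simpa [hw.ne'] using this.symm
    · rintro y ⟨m, rfl⟩
      induction m with
      | zero => exact hvc
      | succ m ih =>
        rw [Function.iterate_succ_apply']
        have := h2 _ ⟨m, rfl⟩
        rw [ih, zero_mul] at this
        exact (mul_eq_zero.1 this).resolve_left hl
  have hvT : ∀ y, y ∉ T → v y = 0 := by
    intro y hy
    by_cases hyC : y ∈ orbit σ c
    · exact hvC y hyC
    · exact hv y (fun h => h.elim hy hyC)
  refine hT l v hvT ?_ hvu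
  ext z
  rw [Pi.smul_apply, smul_eq_mul]
  by_cases hz : z ∈ T
  · rw [h1 z hz, hvc]
    simp
  · rw [hvAc z hz, hvT z hz, mul_zero]

/-- The states met when following `σ` backwards from `u`. -/
inductive Stem (σ : W → W) (u : W) : W → Prop
  | root : Stem σ u u
  | step (y : W) : y ≠ u → Stem σ u (σ y) → Stem σ u y

/-- Start from the stem with all weights one. As long as `T` is not everything, reachability
supplies an edge from some `x ∈ T` to some `c ∉ T`; the `σ`-orbit of `c` is a cycle disjoint from
`T` and is attached at `x`. The induction is on a bound for the size of the complement of `T`. The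
value of `σ` at `u` plays no role. -/
theorem exists_realization_eigTest (u : W) (E : W → W → Prop) (σ : W → W)
    (hσ : Set.InjOn σ {y | y ≠ u}) (hE : ∀ y, y ≠ u → E (σ y) y)
    (hreach : ∀ T : Set W, u ∈ T → (∀ x ∈ T, ∀ y, E x y → y ∈ T) → T = Set.univ) :
    ∃ A : Matrix W W ℝ, (∀ y x, A y x ≠ 0 → y ≠ u ∧ E x y) ∧
      EigTest (A.map Complex.ofReal) u Set.univ := by
  classical
  suffices H : ∀ m : ℕ, ∀ T : Set W, Tᶜ.ncard ≤ m → u ∈ T →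
      (∀ y, y ≠ u → (σ y ∈ T ↔ y ∈ T)) →
      (∃ A : Matrix W W ℝ, (∀ y x, A y x ≠ 0 → y ∈ T ∧ x ∈ T) ∧
        (∀ y x, A y x ≠ 0 → y ≠ u ∧ E x y) ∧ EigTest (A.map Complex.ofReal) u T) →
      ∃ A : Matrix W W ℝ, (∀ y x, A y x ≠ 0 → y ≠ u ∧ E x y) ∧
        EigTest (A.map Complex.ofReal) u Set.univ by
    refine H _ {y | Stem σ u y} le_rfl Stem.root ?_ ?_
    · intro y hy
      refine ⟨Stem.step y hy, fun h => ?_⟩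
      cases h with
      | root => exact absurd rfl hy
      | step _ _ h => exact h
    · refine ⟨Matrix.of fun y x => if y ≠ u ∧ σ y = x ∧ Stem σ u y then 1 else 0, ?_, ?_, ?_⟩
      · intro y x h
        have h' : y ≠ u ∧ σ y = x ∧ Stem σ u y := by
          by_contra h0
          exact h (by simp only [Matrix.of_apply]; rw [if_neg h0])
        obtain ⟨h1, rfl, h3⟩ := h'
        refine ⟨h3, ?_⟩
        cases h3 with
        | root => exact absurd rfl h1
        | step _ _ h => exact h
      · intro y x h
        have h' : y ≠ u ∧ σ y = x ∧ Stem σ u y := by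
          by_contra h0
          exact h (by simp only [Matrix.of_apply]; rw [if_neg h0])
        obtain ⟨h1, rfl, h3⟩ := h'
        exact ⟨h1, hE y h1⟩
      · intro l v hv hvA hvu
        have hz : ∀ y, Stem σ u y → v y = 0 := by
          intro y hy
          induction hy with
          | root => exact hvu
          | step y hyu hy ih =>
            -- In the stem matrix column `σ y` has the single nonzero entry in row `y`, so the zero
            -- of `v` at `σ y` passes to `y`.
            have h := congrFun hvA (σ y)
            rw [Pi.smul_apply, ih, smul_zero] at h
            rw [← h]
            simp only [Matrix.vecMul, dotProduct, Matrix.map_apply, Matrix.of_apply]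
            rw [Finset.sum_eq_single y]
            · rw [if_pos ⟨hyu, rfl, Stem.step y hyu hy⟩]
              simp
            · intro b _ hb
              rw [if_neg]
              · simp
              · rintro ⟨h1, h2, _⟩
                exact hb (hσ h1 hyu h2)
            · simp
        ext y
        by_cases hy : Stem σ u y
        · exact hz y hy
        · exact hv y hy
  intro m
  induction m with
  | zero =>
    rintro T hT huT hcl ⟨A, _, hA2, hA3⟩
    have : Tᶜ = ∅ := (Set.ncard_eq_zero (Set.toFinite _)).1 (Nat.le_zero.1 hT)
    rw [Set.compl_empty_iff] at this
    subst this
    exact ⟨A, hA2, hA3⟩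
  | succ m ih =>
    rintro T hT huT hcl ⟨A, hA1, hA2, hA3⟩
    by_cases hTu : T = Set.univ
    · subst hTu
      exact ⟨A, hA2, hA3⟩
    have : ∃ x ∈ T, ∃ c, E x c ∧ c ∉ T := by
      by_contra! h
      exact hTu (hreach T huT h)
    obtain ⟨x, hx, c, hxc, hc⟩ := this
    obtain ⟨w, hw⟩ := hA3.extend hA1 σ hσ huT hcl hx hc
    have hdis := fun {y} => orbit_disjoint (y := y) huT hcl hc
    have hne : ∀ {y}, y ∈ orbit σ c → y ≠ u := fun hy h => hdis hy (h ▸ huT)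
    have hcc : c ∈ orbit σ c := ⟨0, rfl⟩
    have hentry : ∀ y z, (A + cycleMatrix σ c x w) y z ≠ 0 →
        A y z ≠ 0 ∨ (y ∈ orbit σ c ∧ σ y = z) ∨ (y = c ∧ z = x) := by
      intro y z h
      by_contra! h0
      apply h
      simp only [cycleMatrix, Matrix.add_apply, Matrix.of_apply]
      rw [h0.1, if_neg (fun h => h0.2.1 h.1 h.2), if_neg (fun h => h0.2.2 h.1 h.2)]
      simp
    refine ih (T ∪ orbit σ c) ?_ (Or.inl huT) (orbit_closed huT hσ hcl hc)
      ⟨A + cycleMatrix σ c x w, ?_, ?_, hw⟩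
    · have hlt : (T ∪ orbit σ c)ᶜ.ncard < Tᶜ.ncard := by
        refine Set.ncard_lt_ncard ⟨fun a ha h => ha (Or.inl h), fun h => ?_⟩ (Set.toFinite _)
        exact h hc (Or.inr hcc)
      omega
    · intro y z h
      rcases hentry y z h with h | ⟨h', rfl⟩ | ⟨rfl, rfl⟩
      · exact ⟨Or.inl (hA1 y z h).1, Or.inl (hA1 y z h).2⟩
      · exact ⟨Or.inr h', Or.inr (orbit_apply h')⟩
      · exact ⟨Or.inr hcc, Or.inl hx⟩
    · intro y z h
      rcases hentry y z h with h | ⟨h', rfl⟩ | ⟨rfl, rfl⟩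
      · exact hA2 y z h
      · exact ⟨hne h', hE y (hne h')⟩
      · exact ⟨hne hcc, hxc⟩

end Cactus

/-! ### The graphical characterization of structural controllability -/

section Lin

open Matrix

variable {V : Type*} [Fintype V] [DecidableEq V]

/-- The input becomes an additional vertex `none` whose row is zero, and `B` becomes its column.
Then controllability reduces to the test for the enlarged square matrix. -/
theorem structurallyControllable_of_matching (P : Matrix V V Bool) (Q : Matrix V (Fin 1) Bool)
    (σ : V → Option V) (hinj : Function.Injective σ)
    (hx : ∀ y x, σ y = some x → P y x = true) (hu : ∀ y, σ y = none → Q y 0 = true)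
    (hreach : ∀ T : Set V, (∀ y, Q y 0 = true → y ∈ T) →
      (∀ x ∈ T, ∀ y, P y x = true → y ∈ T) → T = Set.univ) :
    StructurallyControllable P Q := by
  let E : Option V → Option V → Prop := fun a b =>
    match a, b with
    | none, some y => Q y 0 = true
    | some x, some y => P y x = true
    | _, none => False
  obtain ⟨A, hA, hT⟩ := exists_realization_eigTest (W := Option V) none E
    (fun a => a.bind σ) (by
      rintro (_ | a) ha (_ | b) hb h
      · rfl
      · exact absurd rfl ha
      · exact absurd rfl hb
      · exact congrArg some (hinj h)) (by
      rintro (_ | y) hy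
      · exact absurd rfl hy
      · change E (σ y) (some y)
        cases h : σ y with
        | none => exact hu y h
        | some x => exact hx y x h) (by
      intro T hT hcl
      have := hreach {y | some y ∈ T} (fun y hy => hcl none hT (some y) hy)
        (fun x hx y hxy => hcl (some x) hx (some y) hxy)
      ext (_ | y)
      · simpa using hT
      · have : y ∈ {y | some y ∈ T} := this ▸ Set.mem_univ y
        simpa using this)
  have hnone : ∀ a, A none a = 0 := fun a => by
    by_contra h
    exact (hA none a h).1 rfl
  have hReal : ∀ v : Option V → ℝ, (∀ i : ℕ, (v ᵥ* A ^ i) none = 0) → v = 0 := by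
    intro v hv
    have h := hT.eq_zero (fun _ _ _ => Set.mem_univ _) (fun a => (v a : ℂ))
      (fun y hy => absurd (Set.mem_univ y) hy) (fun i => by
        have h1 := congrArg Complex.ofReal (hv i)
        have h2 : (A.map Complex.ofReal) ^ i = (A ^ i).map Complex.ofReal :=
          (map_pow (Complex.ofRealHom.mapMatrix (m := Option V)) A i).symm
        rw [h2]
        simpa [Matrix.vecMul, dotProduct] using h1)
    ext a
    exact Complex.ofReal_eq_zero.1 (congrFun h a)
  let A' : Matrix V V ℝ := Matrix.of fun y x => A (some y) (some x)
  let B' : Matrix V (Fin 1) ℝ := Matrix.of fun y _ => A (some y) none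
  refine ⟨A', B', fun y x h => ?_, fun y j h => ?_, ?_⟩
  · by_contra h0
    have := (hA _ _ h0).2
    change P y x = true at this
    rw [h] at this
    cases this
  · by_contra h0
    have := (hA _ _ h0).2
    change Q y 0 = true at this
    rw [Subsingleton.elim j 0] at h
    rw [h] at this
    cases this
  · rw [controllable_iff]
    intro v hv
    -- The exponent shifts by one because the first step out of `none` is the multiplication by
    -- `B'`.
    have hpow : ∀ i : ℕ, ∀ y, (A ^ (i + 1)) (some y) none = (A' ^ i * B') y 0 ∧
        (A ^ (i + 1)) none none = 0 := by
      intro i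
      induction i with
      | zero =>
        intro y
        simp [B', hnone]
      | succ i ih =>
        intro y
        have hA'B : A' ^ (i + 1) * B' = A' * (A' ^ i * B') := by
          rw [pow_succ', Matrix.mul_assoc]
        rw [hA'B, pow_succ' A (i + 1), Matrix.mul_apply, Matrix.mul_apply, Matrix.mul_apply,
          Fintype.sum_option, (ih y).2]
        refine ⟨?_, Finset.sum_eq_zero fun a _ => by rw [hnone]; exact zero_mul _⟩
        rw [mul_zero, zero_add]
        exact Finset.sum_congr rfl fun z _ => by rw [(ih z).1]; rfl
    -- Extending `v` by 0 at `none` makes the condition for exponent 0 automatic.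
    have h := hReal (fun a => a.elim 0 v) (fun i => by
      cases i with
      | zero => simp
      | succ i =>
        have h1 := congrFun (hv i) 0
        simp only [Matrix.vecMul, dotProduct, Fintype.sum_option, Option.elim_none, zero_mul,
          zero_add, Option.elim_some, Pi.zero_apply] at h1 ⊢
        rw [← h1]
        exact Finset.sum_congr rfl fun y _ => by rw [(hpow i y).1])
    ext y
    exact congrFun h (some y)

/-- Rows outside the closed set `T` vanish in every `A ^ i * B`, so a unit vector outside `T` would
violate the Kalman criterion. -/
theorem StructurallyControllable.reach {P : Matrix V V Bool} {Q : Matrix V (Fin 1) Bool}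
    (h : StructurallyControllable P Q) (T : Set V) (hQ : ∀ y, Q y 0 = true → y ∈ T)
    (hP : ∀ x ∈ T, ∀ y, P y x = true → y ∈ T) : T = Set.univ := by
  obtain ⟨A, B, hA, hB, hc⟩ := h
  rw [controllable_iff] at hc
  by_contra hne
  obtain ⟨z, hz⟩ := (Set.ne_univ_iff_exists_notMem T).1 hne
  have hzero : ∀ i : ℕ, ∀ y, y ∉ T → (A ^ i * B) y 0 = 0 := by
    intro i
    induction i with
    | zero =>
      intro y hy
      rw [pow_zero, Matrix.one_mul]
      exact hB _ _ (by simpa using fun h => hy (hQ y h))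
    | succ i ih =>
      intro y hy
      rw [pow_succ', Matrix.mul_assoc, Matrix.mul_apply]
      refine Finset.sum_eq_zero fun x _ => ?_
      by_cases hx : x ∈ T
      · rw [hA y x (by simpa using fun h => hy (hP x hx y h)), zero_mul]
      · rw [ih x hx, mul_zero]
  have := hc (Pi.single z 1) (fun i => by
    rw [Matrix.single_one_vecMul]
    ext j
    rw [Subsingleton.elim j 0]
    exact hzero i z hz)
  simpa using congrFun this z

/-- A vector killing all rows of `[A B]` kills every `A ^ i * B`, so these rows are independent and
Hall's theorem applies to their supports. -/
theorem StructurallyControllable.exists_matching {P : Matrix V V Bool}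
    {Q : Matrix V (Fin 1) Bool} (h : StructurallyControllable P Q) :
    ∃ σ : V → Option V, Function.Injective σ ∧ (∀ y x, σ y = some x → P y x = true) ∧
      ∀ y, σ y = none → Q y 0 = true := by
  obtain ⟨A, B, hA, hB, hc⟩ := h
  rw [controllable_iff] at hc
  let R : Matrix V (Option V) ℝ := Matrix.of fun y a => a.elim (B y 0) (A y)
  have hR : Function.Injective fun v : V → ℝ => v ᵥ* R := by
    have H : ∀ v : V → ℝ, v ᵥ* R = 0 → v = 0 := by
      intro v hv
      have hvA : v ᵥ* A = 0 := by
        ext x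
        exact congrFun hv (some x)
      refine hc v fun i => ?_
      cases i with
      | zero =>
        ext j
        rw [Subsingleton.elim j 0, pow_zero, Matrix.one_mul]
        exact congrFun hv none
      | succ i => rw [pow_succ', Matrix.mul_assoc, ← Matrix.vecMul_vecMul, hvA, Matrix.zero_vecMul]
    intro v w hvw
    exact sub_eq_zero.1 (H _ (by rw [Matrix.sub_vecMul]; exact sub_eq_zero.2 hvw))
  rw [Matrix.vecMul_injective_iff] at hR
  classical
  let t : V → Finset (Option V) := fun y => Finset.univ.filter fun a => R y a ≠ 0
  obtain ⟨σ, hσ, hσt⟩ := (Finset.all_card_le_biUnion_card_iff_exists_injective t).1 (by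
    intro s
    set N := s.biUnion t
    -- The rows in `s` vanish off `N`, so they stay independent when restricted to `N`; hence there
    -- are at most `N.card` of them.
    have hlin : LinearIndependent ℝ fun y : s => fun a : N => R y a := by
      have h1 := hR.comp (fun y : s => (y : V)) Subtype.val_injective
      rw [Fintype.linearIndependent_iff] at h1 ⊢
      intro g hg
      refine h1 g ?_
      ext a
      by_cases ha : a ∈ N
      · have := congrFun hg ⟨a, ha⟩
        simpa using this
      · rw [Finset.sum_apply]
        refine Finset.sum_eq_zero fun y _ => ?_
        have : R y a = 0 := by
          by_contra h0
          exact ha (Finset.mem_biUnion.2 ⟨y, y.2, by simpa [t] using h0⟩)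
        simp [this]
    have := hlin.fintype_card_le_finrank
    simpa using this)
  refine ⟨σ, hσ, fun y x h => ?_, fun y h => ?_⟩
  · have := hσt y
    rw [h] at this
    simp only [t, Finset.mem_filter] at this
    by_contra h0
    exact this.2 (hA y x (by simpa using h0))
  · have := hσt y
    rw [h] at this
    simp only [t, Finset.mem_filter] at this
    by_contra h0
    exact this.2 (hB y 0 (by simpa using h0))

end Lin

/-! ### Matchings as sets of edges -/

section Matchings

set_option linter.unusedSectionVars false

variable {L R : Type*} [DecidableEq L] [DecidableEq R]

/-- Distinct edges in `M` have no endpoint in common. -/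
def IsMat (M : Finset (L × R)) : Prop :=
  ∀ e ∈ M, ∀ f ∈ M, e ≠ f → e.1 ≠ f.1 ∧ e.2 ≠ f.2

theorem IsMat.eq_of_fst {M : Finset (L × R)} (h : IsMat M) {e f : L × R} (he : e ∈ M) (hf : f ∈ M)
    (hef : e.1 = f.1) : e = f := by
  by_contra hne
  exact (h e he f hf hne).1 hef

theorem IsMat.eq_of_snd {M : Finset (L × R)} (h : IsMat M) {e f : L × R} (he : e ∈ M) (hf : f ∈ M)
    (hef : e.2 = f.2) : e = f := by
  by_contra hne
  exact (h e he f hf hne).2 hef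

theorem isMat_of_eq {M : Finset (L × R)}
    (h1 : ∀ e ∈ M, ∀ f ∈ M, e.1 = f.1 → e = f) (h2 : ∀ e ∈ M, ∀ f ∈ M, e.2 = f.2 → e = f) :
    IsMat M :=
  fun e he f hf hne => ⟨fun h => hne (h1 e he f hf h), fun h => hne (h2 e he f hf h)⟩

theorem IsMat.subset {M M' : Finset (L × R)} (h : IsMat M) (hM : M' ⊆ M) : IsMat M' :=
  fun e he f hf => h e (hM he) f (hM hf)

theorem IsMat.card_image_fst {M : Finset (L × R)} (h : IsMat M) :
    (M.image Prod.fst).card = M.card :=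
  Finset.card_image_of_injOn fun _ he _ hf hef => h.eq_of_fst he hf hef

theorem IsMat.card_image_snd {M : Finset (L × R)} (h : IsMat M) :
    (M.image Prod.snd).card = M.card :=
  Finset.card_image_of_injOn fun _ he _ hf hef => h.eq_of_snd he hf hef

theorem IsMat.union {M M' : Finset (L × R)} (h : IsMat M) (h' : IsMat M')
    (h1 : ∀ e ∈ M, ∀ f ∈ M', e.1 ≠ f.1) (h2 : ∀ e ∈ M, ∀ f ∈ M', e.2 ≠ f.2) :
    IsMat (M ∪ M') := by
  intro e he f hf hne
  rcases Finset.mem_union.1 he with he | he <;> rcases Finset.mem_union.1 hf with hf | hf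
  · exact h e he f hf hne
  · exact ⟨h1 e he f hf, h2 e he f hf⟩
  · exact ⟨(h1 f hf e he).symm, (h2 f hf e he).symm⟩
  · exact h' e he f hf hne

/-- Left endpoints at which the edges of `M₂` are used to combine `M₁` and `M₂`. -/
inductive Switch (M₁ M₂ : Finset (L × R)) : L → Prop
  | base (e : L × R) : e ∈ M₂ → (∀ f ∈ M₁, f.1 ≠ e.1) → Switch M₁ M₂ e.1
  | step (e f : L × R) : e ∈ M₂ → f ∈ M₁ → e.2 = f.2 → Switch M₁ M₂ e.1 → Switch M₁ M₂ f.1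

/-- The Mendelsohn–Dulmage theorem. -/
theorem IsMat.exists_cover {M₁ M₂ : Finset (L × R)} (h₁ : IsMat M₁) (h₂ : IsMat M₂) :
    ∃ M ⊆ M₁ ∪ M₂, IsMat M ∧ (∀ e ∈ M₂, ∃ f ∈ M, f.1 = e.1) ∧ ∀ e ∈ M₁, ∃ f ∈ M, f.2 = e.2 := by
  classical
  -- `Switch` marks the left ends of the alternating paths that start at left nodes covered by `M₂`
  -- only. `M₂` is used on these paths and `M₁` elsewhere.
  refine ⟨M₁.filter (fun e => ¬ Switch M₁ M₂ e.1) ∪ M₂.filter (fun e => Switch M₁ M₂ e.1), ?_, ?_,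
    ?_, ?_⟩
  · exact Finset.union_subset_union (Finset.filter_subset _ _) (Finset.filter_subset _ _)
  · refine (h₁.subset (Finset.filter_subset _ _)).union (h₂.subset (Finset.filter_subset _ _)) ?_ ?_
    · intro e he f hf h
      rw [Finset.mem_filter] at he hf
      exact he.2 (h ▸ hf.2)
    · intro e he f hf h
      rw [Finset.mem_filter] at he hf
      exact he.2 (Switch.step f e hf.1 he.1 h.symm hf.2)
  · intro e he
    by_cases hs : Switch M₁ M₂ e.1
    · exact ⟨e, Finset.mem_union_right _ (Finset.mem_filter.2 ⟨he, hs⟩), rfl⟩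
    · have : ∃ f ∈ M₁, f.1 = e.1 := by
        by_contra! h
        exact hs (Switch.base e he h)
      obtain ⟨f, hf, hfe⟩ := this
      exact ⟨f, Finset.mem_union_left _ (Finset.mem_filter.2 ⟨hf, hfe ▸ hs⟩), hfe⟩
  · intro e he
    by_cases hs : Switch M₁ M₂ e.1
    · have key : ∀ l, Switch M₁ M₂ l → l = e.1 → ∃ f ∈ M₂, Switch M₁ M₂ f.1 ∧ f.2 = e.2 := by
        intro l hl
        cases hl with
        | base f hf hf' => exact fun h => absurd h.symm (hf' e he)
        | step f g hf hg hfg hs' =>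
          intro h
          exact ⟨f, hf, hs', by rw [hfg, h₁.eq_of_fst hg he h]⟩
      obtain ⟨f, hf, hfs, hfe⟩ := key _ hs rfl
      exact ⟨f, Finset.mem_union_right _ (Finset.mem_filter.2 ⟨hf, hfs⟩), hfe⟩
    · exact ⟨e, Finset.mem_union_left _ (Finset.mem_filter.2 ⟨he, hs⟩), rfl⟩

/-- `M` is a matching of maximum size with edges in `E`. -/
def IsMaxMat (E M : Finset (L × R)) : Prop :=
  M ⊆ E ∧ IsMat M ∧ ∀ M' ⊆ E, IsMat M' → M'.card ≤ M.card

theorem exists_isMaxMat (E : Finset (L × R)) : ∃ M, IsMaxMat E M := by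
  classical
  obtain ⟨M, hM, hmax⟩ := Finset.exists_max_image (E.powerset.filter IsMat) Finset.card
    ⟨∅, Finset.mem_filter.2 ⟨Finset.empty_mem_powerset _, fun e he => by simp at he⟩⟩
  rw [Finset.mem_filter, Finset.mem_powerset] at hM
  exact ⟨M, hM.1, hM.2, fun M' h h' => hmax M'
    (Finset.mem_filter.2 ⟨Finset.mem_powerset.2 h, h'⟩)⟩

end Matchings

/-! ### The edges of the bipartite graphs -/

section Edges

variable {k n : ℕ} {As : Matrix (Fin n) (Fin n) Bool} {B : Matrix (State k n) (Fin 1) Bool}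

@[simp]
theorem state_mem_edgesX {y x : State k n} :
    (y, RightNode.state x) ∈ edgesX As ↔ y.1 = x.1 ∧ As y.2 x.2 = true := by
  simp [edgesX]

@[simp]
theorem input_notMem_edgesX {y : State k n} {u : Fin 1} : (y, RightNode.input u) ∉ edgesX As := by
  simp [edgesX]

@[simp]
theorem scc_notMem_edgesX {y : State k n} {S : Finset (State k n)} :
    (y, RightNode.scc S) ∉ edgesX As := by
  simp [edgesX]

@[simp]
theorem state_mem_edgesI {y x : State k n} :
    (y, RightNode.state x) ∈ edgesI k n ↔ y.1 ≠ x.1 := by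
  simp [edgesI]

@[simp]
theorem input_notMem_edgesI {y : State k n} {u : Fin 1} :
    (y, RightNode.input u) ∉ edgesI k n := by
  simp [edgesI]

@[simp]
theorem scc_notMem_edgesI {y : State k n} {S : Finset (State k n)} :
    (y, RightNode.scc S) ∉ edgesI k n := by
  simp [edgesI]

@[simp]
theorem state_notMem_edgesU {y x : State k n} : (y, RightNode.state x) ∉ edgesU B := by
  simp [edgesU]

@[simp]
theorem input_mem_edgesU {y : State k n} {u : Fin 1} :
    (y, RightNode.input u) ∈ edgesU B ↔ B y u = true := by
  simp [edgesU]

@[simp]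
theorem scc_notMem_edgesU {y : State k n} {S : Finset (State k n)} :
    (y, RightNode.scc S) ∉ edgesU B := by
  simp [edgesU]

@[simp]
theorem state_notMem_edgesN {y x : State k n} : (y, RightNode.state x) ∉ edgesN As B := by
  simp [edgesN]

@[simp]
theorem input_notMem_edgesN {y : State k n} {u : Fin 1} :
    (y, RightNode.input u) ∉ edgesN As B := by
  simp [edgesN]

@[simp]
theorem scc_mem_edgesN {y : State k n} {S : Finset (State k n)} :
    (y, RightNode.scc S) ∈ edgesN As B ↔ S ∈ inaccessibleSCCs As B ∧ y ∈ S := by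
  simp [edgesN]

/-- The number of states. -/
theorem card_state : Fintype.card (State k n) = k * n := by
  simp [State]

theorem card_systemNodes : (systemNodes k n).card = k * n + 1 := by
  unfold systemNodes
  rw [Finset.card_union_of_disjoint, Finset.card_image_of_injective _ (fun _ _ h => by
    simpa using h), Finset.card_image_of_injective _ (fun _ _ h => by simpa using h)]
  · simp
  · rw [Finset.disjoint_left]
    intro a ha hb
    obtain ⟨x, -, rfl⟩ := Finset.mem_image.1 ha
    obtain ⟨u, -, h⟩ := Finset.mem_image.1 hb
    cases h

theorem isPerfectMatching_bipABN {M : Finset (Edge k n)} :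
    (bipABN As B).IsPerfectMatching M ↔
      M ⊆ edgesX As ∪ edgesI k n ∪ edgesU B ∪ edgesN As B ∧ IsMat M ∧ M.card = k * n := by
  have h : min (bipABN As B).left.card (bipABN As B).right.card = k * n := by
    have := Finset.card_le_card
      (Finset.subset_union_left (s₁ := systemNodes k n)
        (s₂ := (inaccessibleSCCs As B).image RightNode.scc))
    rw [card_systemNodes] at this
    simp only [bipABN, Finset.card_univ, card_state]
    omega
  unfold BipGraph.IsPerfectMatching BipGraph.IsMatching
  rw [h, and_assoc]
  rfl

/-- The cost of an edge, in terms of the classes of edges that contain it. -/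
theorem cost_add {e : Edge k n}
    (he : e ∈ edgesX As ∪ edgesI k n ∪ edgesU B ∪ edgesN As B) :
    cost e + (if e ∉ edgesI k n then 1 else 0) + (if e ∈ edgesX As ∪ edgesU B then 1 else 0) +
      (if e ∈ edgesU B then 1 else 0) = 3 := by
  obtain ⟨y, x | u | S⟩ := e
  · by_cases h : y.1 = x.1
    · have : As y.2 x.2 = true := by simpa [h] using he
      simp [cost, h, this]
    · simp [cost, h]
  · have : B y u = true := by simpa using he
    simp [cost, this]
  · simp [cost]

/-- For perfect matchings the right-hand side is constant, so minimising the cost is maximising the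
sum of the three cardinalities. -/
theorem sum_cost_add {M : Finset (Edge k n)}
    (hM : M ⊆ edgesX As ∪ edgesI k n ∪ edgesU B ∪ edgesN As B) :
    ∑ e ∈ M, cost e + (M \ edgesI k n).card + (M ∩ (edgesX As ∪ edgesU B)).card +
      (M ∩ edgesU B).card = 3 * M.card := by
  have h := Finset.sum_congr rfl fun e he => cost_add (hM he)
  simp only [Finset.sum_add_distrib, ← Finset.card_filter, Finset.sum_const, smul_eq_mul] at h
  rw [← Finset.filter_notMem_eq_sdiff, ← Finset.filter_mem_eq_inter, ← Finset.filter_mem_eq_inter,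
    h, mul_comm]

theorem IsMat.card_inter_edgesU_le {M : Finset (Edge k n)} (hM : IsMat M) :
    (M ∩ edgesU B).card ≤ 1 := by
  rw [Finset.card_le_one]
  intro e he f hf
  rw [Finset.mem_inter] at he hf
  apply hM.eq_of_snd he.1 hf.1
  obtain ⟨y, x | u | S⟩ := e <;> obtain ⟨z, x' | u' | S'⟩ := f <;> simp at he hf ⊢
  exact Subsingleton.elim _ _

end Edges

/-! ### Completing maximum matchings by interconnections -/

section Completion

variable {k n : ℕ} {As : Matrix (Fin n) (Fin n) Bool} {B : Matrix (State k n) (Fin 1) Bool}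

theorem composite_eq_true {F : Finset (State k n × State k n)} {x y : State k n} :
    composite As F y x = true ↔ localAdj As x y ∨ (x.1 ≠ y.1 ∧ (x, y) ∈ F) := by
  unfold composite localAdj
  rw [Matrix.of_apply]
  by_cases h : y.1 = x.1
  · simp [h]
  · have h' : x.1 ≠ y.1 := fun h' => h h'.symm
    simp [h, h']

/-- The bipartite edges of the composite system with interconnections `F`. -/
def linkEdges (F : Finset (State k n × State k n)) : Finset (Edge k n) :=
  F.image fun e => (e.2, RightNode.state e.1)

theorem exists_matching_of_structurallyControllable {F : Finset (State k n × State k n)}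
    (h : StructurallyControllable (composite As F) B) :
    ∃ M ⊆ edgesX As ∪ edgesU B ∪ linkEdges F, IsMat M ∧ M.card = k * n := by
  obtain ⟨σ, hinj, hx, hu⟩ := h.exists_matching
  let r : Option (State k n) → RightNode k n := fun a => a.elim (.input 0) .state
  have hr : Function.Injective r := by
    rintro (_ | a) (_ | b) h
    · rfl
    · cases h
    · cases h
    · exact congrArg some (RightNode.state.inj h)
  refine ⟨Finset.univ.image fun y => (y, r (σ y)), ?_, ?_, ?_⟩
  · intro e he
    obtain ⟨y, -, rfl⟩ := Finset.mem_image.1 he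
    cases h : σ y with
    | none => simp [r, hu y h]
    | some x =>
      rcases composite_eq_true.1 (hx y x h) with h | h
      · simp [r, h.1, h.2]
      · refine Finset.mem_union_right _ (Finset.mem_image.2 ⟨(x, y), h.2, rfl⟩)
  · apply isMat_of_eq
    · simp
    · simp only [Finset.mem_image, Finset.mem_univ, true_and]
      rintro _ ⟨y, rfl⟩ _ ⟨z, rfl⟩ h
      rw [hinj (hr h)]
  · rw [Finset.card_image_of_injective _ (fun _ _ h => (Prod.mk.inj h).1), Finset.card_univ,
      card_state]

theorem linkEdges_subset {F : Finset (State k n × State k n)}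
    (hF : F ⊆ allInterconnections k n) : linkEdges F ⊆ edgesI k n := by
  intro e he
  obtain ⟨a, ha, rfl⟩ := Finset.mem_image.1 he
  have := (Finset.mem_filter.1 (hF ha)).2
  simpa using this.symm

/-- Moving an edge into the `i`-th subsystem. -/
def moveEdge (i : Fin k) (e : Edge k n) : Edge k n :=
  ((i, e.1.2), match e.2 with
    | .state x => .state (i, x.2)
    | r => r)

theorem card_subsystem (i : Fin k) :
    (Finset.univ.filter fun y : State k n => y.1 = i).card = n := by
  have : (Finset.univ.filter fun y : State k n => y.1 = i) =
      Finset.univ.image fun p : Fin n => (i, p) := by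
    ext ⟨a, b⟩
    simp [eq_comm]
  rw [this, Finset.card_image_of_injective _ (fun _ _ h => (Prod.mk.inj h).2)]
  simp

/-- A maximum matching has, in the `i`-th subsystem, at least as many edges as it has edges inside
the `j`-th subsystem. -/
theorem IsMaxMat.card_filter_le {M : Finset (Edge k n)}
    (hM : IsMaxMat (edgesX As ∪ edgesU B) M) {i j : Fin k} (hij : i ≠ j) :
    (M.filter fun e => e.1.1 = j ∧ e ∈ edgesX As).card ≤ (M.filter fun e => e.1.1 = i).card := by
  obtain ⟨hsub, hmat, hmax⟩ := hM
  set P := M.filter fun e => e.1.1 = j ∧ e ∈ edgesX As with hP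
  have hPform : ∀ e ∈ P, ∃ p q, e = ((j, p), RightNode.state (j, q)) ∧ As p q = true := by
    rintro ⟨⟨a, p⟩, r⟩ he
    obtain ⟨_, h1, h2⟩ := Finset.mem_filter.1 he
    rcases r with ⟨b, q⟩ | u | S
    · simp only [state_mem_edgesX] at h2
      obtain ⟨h2, h3⟩ := h2
      subst h1
      subst h2
      exact ⟨p, q, rfl, h3⟩
    · simp at h2
    · simp at h2
  have hPmat : IsMat P := hmat.subset (Finset.filter_subset _ _)
  have hinj : Set.InjOn (moveEdge i) (P : Set (Edge k n)) := by
    intro e he f hf h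
    obtain ⟨p, q, rfl, _⟩ := hPform e he
    obtain ⟨p', q', rfl, _⟩ := hPform f hf
    simp only [moveEdge, Prod.mk.injEq, RightNode.state.injEq, true_and] at h
    rw [h.1, h.2]
  have hmv : IsMat (P.image (moveEdge i)) := by
    apply isMat_of_eq <;> intro a ha b hb hab <;>
      obtain ⟨e, he, rfl⟩ := Finset.mem_image.1 ha <;>
      obtain ⟨f, hf, rfl⟩ := Finset.mem_image.1 hb <;>
      obtain ⟨p, q, rfl, _⟩ := hPform e he <;>
      obtain ⟨p', q', rfl, _⟩ := hPform f hf <;>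
      simp only [moveEdge, Prod.mk.injEq, RightNode.state.injEq, true_and] at hab <;>
      subst hab
    · rw [hPmat.eq_of_fst he hf rfl]
    · rw [hPmat.eq_of_snd he hf rfl]
  set O := M.filter fun e => ¬ e.1.1 = i with hO
  have hfst : ∀ e ∈ O, ∀ f ∈ P.image (moveEdge i), e.1 ≠ f.1 := by
    intro e he f hf h
    obtain ⟨g, hg, rfl⟩ := Finset.mem_image.1 hf
    exact (Finset.mem_filter.1 he).2 (by rw [h]; rfl)
  have hsnd : ∀ e ∈ O, ∀ f ∈ P.image (moveEdge i), e.2 ≠ f.2 := by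
    intro e he f hf h
    obtain ⟨g, hg, rfl⟩ := Finset.mem_image.1 hf
    obtain ⟨p, q, rfl, _⟩ := hPform g hg
    obtain ⟨y, r⟩ := e
    simp only [moveEdge] at h
    subst h
    have h1 := hsub (Finset.mem_filter.1 he).1
    simp only [Finset.mem_union, state_mem_edgesX, state_notMem_edgesU, or_false] at h1
    exact (Finset.mem_filter.1 he).2 h1.1
  -- Exchange: the edges of `M` with left end in subsystem `i` give way to copies of the internal
  -- edges of subsystem `j`. The remaining edges end, on the right, at the input or outside
  -- subsystem `i`, so the result is a matching and maximality compares the two numbers.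
  have hle := hmax (O ∪ P.image (moveEdge i)) (by
    apply Finset.union_subset ((Finset.filter_subset _ _).trans hsub)
    intro f hf
    obtain ⟨g, hg, rfl⟩ := Finset.mem_image.1 hf
    obtain ⟨p, q, rfl, h⟩ := hPform g hg
    simp [moveEdge, h])
    ((hmat.subset (Finset.filter_subset _ _)).union hmv hfst hsnd)
  rw [Finset.card_union_of_disjoint (Finset.disjoint_left.2 fun e he hf => hfst e he e hf rfl),
    Finset.card_image_of_injOn hinj] at hle
  have := Finset.card_filter_add_card_filter_not (s := M) (fun e => e.1.1 = i)
  rw [← hO] at this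
  omega

/-- Both sides of a subsystem have `n` nodes, and a right node in subsystem `j` can only be covered
by an internal edge of `j`. So the comparison of covered nodes in `IsMaxMat.card_filter_le` turns
into one of uncovered nodes. -/
theorem IsMaxMat.card_uncovered_le {M : Finset (Edge k n)}
    (hM : IsMaxMat (edgesX As ∪ edgesU B) M) {i j : Fin k} (hij : i ≠ j) :
    (Finset.univ.filter fun y : State k n => y.1 = i ∧ ∀ e ∈ M, e.1 ≠ y).card ≤
      (Finset.univ.filter fun x : State k n =>
        x.1 = j ∧ ∀ e ∈ M, e.2 ≠ RightNode.state x).card := by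
  have h := hM.card_filter_le hij
  obtain ⟨hsub, hmat, -⟩ := hM
  have h1 : (M.filter fun e => e.1.1 = i).card +
      (Finset.univ.filter fun y : State k n => y.1 = i ∧ ∀ e ∈ M, e.1 ≠ y).card ≤ n := by
    refine le_of_le_of_eq ?_ (card_subsystem (n := n) i)
    rw [← (hmat.subset (Finset.filter_subset _ _)).card_image_fst, ← Finset.card_union_of_disjoint]
    · apply Finset.card_le_card
      intro y hy
      rcases Finset.mem_union.1 hy with hy | hy
      · obtain ⟨e, he, rfl⟩ := Finset.mem_image.1 hy
        exact Finset.mem_filter.2 ⟨Finset.mem_univ _, (Finset.mem_filter.1 he).2⟩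
      · exact Finset.mem_filter.2 ⟨Finset.mem_univ _, (Finset.mem_filter.1 hy).2.1⟩
    · rw [Finset.disjoint_left]
      intro y hy hy'
      obtain ⟨e, he, rfl⟩ := Finset.mem_image.1 hy
      exact (Finset.mem_filter.1 hy').2.2 e (Finset.mem_filter.1 he).1 rfl
  have h2 : n ≤ (M.filter fun e => e.1.1 = j ∧ e ∈ edgesX As).card +
      (Finset.univ.filter fun x : State k n =>
        x.1 = j ∧ ∀ e ∈ M, e.2 ≠ RightNode.state x).card := by
    have h3 : (Finset.univ.filter fun y : State k n => y.1 = j).card ≤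
        ((M.filter fun e => e.1.1 = j ∧ e ∈ edgesX As).image Prod.snd ∪
        (Finset.univ.filter fun x : State k n =>
          x.1 = j ∧ ∀ e ∈ M, e.2 ≠ RightNode.state x).image RightNode.state).card := by
      rw [← Finset.card_image_of_injective (f := RightNode.state (k := k) (n := n)) _
        (fun _ _ h => RightNode.state.inj h)]
      apply Finset.card_le_card
      intro r hr
      obtain ⟨x, hx, rfl⟩ := Finset.mem_image.1 hr
      have hxj := (Finset.mem_filter.1 hx).2
      by_cases hc : ∀ e ∈ M, e.2 ≠ RightNode.state x
      · exact Finset.mem_union_right _ (Finset.mem_image_of_mem _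
          (Finset.mem_filter.2 ⟨Finset.mem_univ _, hxj, hc⟩))
      · push Not at hc
        obtain ⟨⟨y, r⟩, he, h⟩ := hc
        simp only at h
        subst h
        have h4 := hsub he
        simp only [Finset.mem_union, state_mem_edgesX, state_notMem_edgesU, or_false] at h4
        refine Finset.mem_union_left _ (Finset.mem_image.2 ⟨_, Finset.mem_filter.2
          ⟨he, ?_, ?_⟩, rfl⟩)
        · exact h4.1.trans hxj
        · simpa using h4
    rw [card_subsystem] at h3
    refine h3.trans ((Finset.card_union_le _ _).trans ?_)
    exact Nat.add_le_add Finset.card_image_le Finset.card_image_le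
  omega

theorem exists_mapsTo_injOn {α : Type*} [Nonempty α] {s t : Finset α} (h : s.card ≤ t.card) :
    ∃ f : α → α, Set.MapsTo f s t ∧ Set.InjOn f s := by
  refine s.finite_toSet.exists_injOn_of_encard_le (t := (t : Set α)) ?_
  rw [Set.encard_coe_eq_coe_finsetCard, Set.encard_coe_eq_coe_finsetCard]
  exact_mod_cast h

/-- A fixed-point-free injection `τ` of the subsystems sends the uncovered left nodes of subsystem
`i` injectively to free right nodes of subsystem `τ i`; distinct subsystems have distinct targets,
so the pieces do not collide. -/
theorem exists_completion_map
    (hfull : StructurallyControllable (composite As (allInterconnections k n)) B)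
    {M : Finset (Edge k n)} (hM : IsMaxMat (edgesX As ∪ edgesU B) M) :
    ∃ g : State k n → State k n, Set.InjOn g {y | ∀ e ∈ M, e.1 ≠ y} ∧
      ∀ y, (∀ e ∈ M, e.1 ≠ y) → y.1 ≠ (g y).1 ∧ ∀ e ∈ M, e.2 ≠ RightNode.state (g y) := by
  by_cases hk : ∃ τ : Fin k → Fin k, Function.Injective τ ∧ ∀ i, i ≠ τ i
  · obtain ⟨τ, hτ, hτ'⟩ := hk
    have hf : ∀ i, ∃ f : State k n → State k n,
        Set.MapsTo f (Finset.univ.filter fun y : State k n => y.1 = i ∧ ∀ e ∈ M, e.1 ≠ y)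
          (Finset.univ.filter fun x : State k n =>
            x.1 = τ i ∧ ∀ e ∈ M, e.2 ≠ RightNode.state x) ∧
        Set.InjOn f (Finset.univ.filter fun y : State k n => y.1 = i ∧ ∀ e ∈ M, e.1 ≠ y) := by
      intro i
      rcases isEmpty_or_nonempty (State k n) with h | h
      · exact ⟨id, fun y _ => h.elim y, fun y _ => h.elim y⟩
      · exact exists_mapsTo_injOn (hM.card_uncovered_le (hτ' i))
    choose f hf hfi using hf
    have hg : ∀ y : State k n, (∀ e ∈ M, e.1 ≠ y) →
        (f y.1 y).1 = τ y.1 ∧ ∀ e ∈ M, e.2 ≠ RightNode.state (f y.1 y) := by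
      intro y hy
      have := hf y.1 (x := y) (by simpa using fun a b c => hy (a, b) c)
      simpa using this
    refine ⟨fun y => f y.1 y, ?_, ?_⟩
    · intro y hy z hz h
      have h1 : y.1 = z.1 := hτ (by rw [← (hg y hy).1, ← (hg z hz).1]; exact congrArg Prod.fst h)
      refine hfi y.1 ?_ ?_ (by simpa [h1] using h)
      · simpa using fun a b c => hy (a, b) c
      · simpa [h1] using fun a b c => hz (a, b) c
    · intro y hy
      exact ⟨by rw [(hg y hy).1]; exact hτ' _, (hg y hy).2⟩
  -- With two or more subsystems the cyclic shift is such a `τ`. With at most one there are no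
  -- interconnections, so `hfull` gives a full matching within X ∪ U, and the maximum matching `M`
  -- leaves no left node uncovered.
  · have hk1 : k ≤ 1 := by
      by_contra hk1
      push Not at hk1
      obtain ⟨m, rfl⟩ : ∃ m, k = m + 2 := ⟨k - 2, by omega⟩
      refine hk ⟨fun i => i + 1, add_left_injective 1, fun i h => ?_⟩
      have : (1 : Fin (m + 2)) = 0 := by simpa using h.symm
      simp at this
    have hsub : Subsingleton (Fin k) := Fin.subsingleton_iff_le_one.2 hk1
    obtain ⟨M', hM', hmat, hcard⟩ := exists_matching_of_structurallyControllable hfull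
    have hle := hM.2.2 M' (by
      intro e he
      rcases Finset.mem_union.1 (hM' he) with h | h
      · exact h
      · obtain ⟨a, ha, -⟩ := Finset.mem_image.1 h
        exact absurd (Subsingleton.elim _ _) (Finset.mem_filter.1 ha).2) hmat
    have hall : M.image Prod.fst = Finset.univ := by
      rw [← Finset.card_eq_iff_eq_univ, hM.2.1.card_image_fst, card_state]
      apply le_antisymm _ (hcard ▸ hle)
      rw [← hM.2.1.card_image_fst, ← card_state (k := k) (n := n)]
      exact Finset.card_le_univ _
    have hno : ∀ y, ¬ ∀ e ∈ M, e.1 ≠ y := by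
      intro y hy
      have : y ∈ M.image Prod.fst := hall ▸ Finset.mem_univ y
      obtain ⟨e, he, h⟩ := Finset.mem_image.1 this
      exact hy e he h
    exact ⟨id, fun y hy => absurd hy (hno y), fun y hy => absurd hy (hno y)⟩

/-- A matching whose edges in the subsystems and at the input are of maximum number is completed
by interconnections. -/
theorem exists_completion
    (hfull : StructurallyControllable (composite As (allInterconnections k n)) B)
    {M : Finset (Edge k n)} (hM : M ⊆ edgesX As ∪ edgesU B ∪ edgesN As B) (hmat : IsMat M)
    (hmax : IsMaxMat (edgesX As ∪ edgesU B) (M ∩ (edgesX As ∪ edgesU B))) :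
    ∃ K ⊆ edgesI k n, IsMat (M ∪ K) ∧ (M ∪ K).card = k * n ∧
      (∀ e ∈ M, ∀ f ∈ K, e.1 ≠ f.1) ∧ (∀ e ∈ M, ∀ f ∈ K, e.2 ≠ f.2) := by
  obtain ⟨g, hg, hg'⟩ := exists_completion_map hfull hmax
  have hun : ∀ y, (∀ e ∈ M, e.1 ≠ y) → ∀ e ∈ M ∩ (edgesX As ∪ edgesU B), e.1 ≠ y :=
    fun y hy e he => hy e (Finset.mem_inter.1 he).1
  set K : Finset (Edge k n) := (Finset.univ.filter fun y : State k n => ∀ e ∈ M, e.1 ≠ y).image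
    fun y => (y, RightNode.state (g y)) with hK
  have hKmem : ∀ f ∈ K, ∃ y, (∀ e ∈ M, e.1 ≠ y) ∧ f = (y, RightNode.state (g y)) := by
    intro f hf
    obtain ⟨y, hy, rfl⟩ := Finset.mem_image.1 hf
    exact ⟨y, (Finset.mem_filter.1 hy).2, rfl⟩
  have h1 : ∀ e ∈ M, ∀ f ∈ K, e.1 ≠ f.1 := by
    intro e he f hf
    obtain ⟨y, hy, rfl⟩ := hKmem f hf
    exact hy e he
  have h2 : ∀ e ∈ M, ∀ f ∈ K, e.2 ≠ f.2 := by
    intro e he f hf h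
    obtain ⟨y, hy, rfl⟩ := hKmem f hf
    refine (hg' y (hun y hy)).2 e (Finset.mem_inter.2 ⟨he, ?_⟩) h
    rcases Finset.mem_union.1 (hM he) with h3 | h3
    · exact h3
    · obtain ⟨z, r⟩ := e
      simp only at h
      subst h
      simp at h3
  have hKmat : IsMat K := by
    apply isMat_of_eq <;> intro a ha b hb hab <;>
      obtain ⟨y, hy, rfl⟩ := hKmem a ha <;> obtain ⟨z, hz, rfl⟩ := hKmem b hb
    · simp only at hab
      rw [hab]
    · rw [hg (hun y hy) (hun z hz) (RightNode.state.inj hab)]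
  refine ⟨K, ?_, hmat.union hKmat h1 h2, ?_, h1, h2⟩
  · intro f hf
    obtain ⟨y, hy, rfl⟩ := hKmem f hf
    simpa using (hg' y (hun y hy)).1
  · rw [← (hmat.union hKmat h1 h2).card_image_fst, ← card_state (k := k) (n := n),
      Finset.card_eq_iff_eq_univ, Finset.eq_univ_iff_forall]
    intro y
    by_cases hy : ∀ e ∈ M, e.1 ≠ y
    · exact Finset.mem_image.2 ⟨(y, .state (g y)), Finset.mem_union_right _ (Finset.mem_image.2
        ⟨y, Finset.mem_filter.2 ⟨Finset.mem_univ _, hy⟩, rfl⟩), rfl⟩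
    · push Not at hy
      obtain ⟨e, he, h⟩ := hy
      exact Finset.mem_image.2 ⟨e, Finset.mem_union_left _ he, h⟩

end Completion

/-! ### Optimum matchings -/

section Optimum

variable {k n : ℕ} {As : Matrix (Fin n) (Fin n) Bool} {B : Matrix (State k n) (Fin 1) Bool}

theorem IsMaxMat.of_card_le {L R : Type*} {E M M' : Finset (L × R)}
    (h : IsMaxMat E M) (hM' : M' ⊆ E) (hmat : IsMat M') (hle : M.card ≤ M'.card) :
    IsMaxMat E M' :=
  ⟨hM', hmat, fun M'' h1 h2 => (h.2.2 M'' h1 h2).trans hle⟩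

theorem exists_input (hk : 0 < k) (hn : 0 < n) {F : Finset (State k n × State k n)}
    (h : StructurallyControllable (composite As F) B) : ∃ y, B y 0 = true := by
  by_contra hB
  have := h.reach ∅ (fun y hy => absurd ⟨y, hy⟩ hB) (fun _ h => absurd h (Set.notMem_empty _))
  have hmem : ((⟨0, hk⟩, ⟨0, hn⟩) : State k n) ∈ (∅ : Set (State k n)) := this ▸ Set.mem_univ _
  exact hmem

/-- If the input is unused, the input edge at `y₀` can be put in at the price of at most one edge,
the one at `y₀`. -/
theorem exists_isMaxMat_input {y₀ : State k n} (hy₀ : B y₀ 0 = true) :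
    ∃ M, IsMaxMat (edgesX As ∪ edgesU B) M ∧ ∃ y, (y, RightNode.input 0) ∈ M := by
  obtain ⟨M, hM⟩ := exists_isMaxMat (edgesX As ∪ edgesU B)
  by_cases hu : ∃ y, (y, RightNode.input 0) ∈ M
  · exact ⟨M, hM, hu⟩
  refine ⟨{(y₀, RightNode.input 0)} ∪ M.filter (fun e => e.1 ≠ y₀), ?_, y₀, by simp⟩
  have h1 : ∀ e ∈ ({(y₀, RightNode.input 0)} : Finset (Edge k n)),
      ∀ f ∈ M.filter (fun e => e.1 ≠ y₀), e.1 ≠ f.1 := by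
    intro e he f hf h
    rw [Finset.mem_singleton] at he
    subst he
    exact (Finset.mem_filter.1 hf).2 h.symm
  refine hM.of_card_le ?_ ?_ ?_
  · apply Finset.union_subset
    · simpa using hy₀
    · exact (Finset.filter_subset _ _).trans hM.1
  · refine IsMat.union ?_ (hM.2.1.subset (Finset.filter_subset _ _)) h1 ?_
    · intro e he f hf hne
      rw [Finset.mem_singleton] at he hf
      exact absurd (he.trans hf.symm) hne
    · intro e he f hf h
      rw [Finset.mem_singleton] at he
      subst he
      obtain ⟨z, r⟩ := f
      simp only at h
      subst h
      exact hu ⟨z, (Finset.mem_filter.1 hf).1⟩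
  · rw [Finset.card_union_of_disjoint (Finset.disjoint_left.2 fun e he hf => h1 e he e hf rfl),
      Finset.card_singleton]
    have h2 := Finset.card_filter_add_card_filter_not (s := M) (fun e => e.1 ≠ y₀)
    have h3 : (M.filter fun e => ¬ e.1 ≠ y₀).card ≤ 1 := by
      rw [Finset.card_le_one]
      intro e he f hf
      rw [Finset.mem_filter, not_not] at he hf
      exact hM.2.1.eq_of_fst he.1 hf.1 (he.2.trans hf.2.symm)
    omega

theorem sdiff_edgesI_subset {M : Finset (Edge k n)}
    (hM : M ⊆ edgesX As ∪ edgesI k n ∪ edgesU B ∪ edgesN As B) :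
    M \ edgesI k n ⊆ edgesX As ∪ edgesU B ∪ edgesN As B := by
  intro e he
  rw [Finset.mem_sdiff] at he
  have := hM he.1
  simp only [Finset.mem_union] at this ⊢
  tauto

theorem disjoint_edgesI {e : Edge k n} (he : e ∈ edgesX As ∪ edgesU B ∪ edgesN As B) :
    e ∉ edgesI k n := by
  obtain ⟨y, x | u | S⟩ := e
  · simp only [Finset.mem_union, state_mem_edgesX, state_notMem_edgesU, state_notMem_edgesN,
      or_false] at he
    simpa using he.1
  · simp
  · simp

/-- A perfect matching that is optimal for all the quantities entering the cost. -/
theorem exists_best_matching (hk : 0 < k) (hn : 0 < n)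
    (hfull : StructurallyControllable (composite As (allInterconnections k n)) B) :
    ∃ M, (bipABN As B).IsPerfectMatching M ∧
      IsMaxMat (edgesX As ∪ edgesU B) (M ∩ (edgesX As ∪ edgesU B)) ∧
      IsMaxMat (edgesX As ∪ edgesU B ∪ edgesN As B) (M \ edgesI k n) ∧
      (M ∩ edgesU B).card = 1 := by
  obtain ⟨y₀, hy₀⟩ := exists_input hk hn hfull
  obtain ⟨M₁, hM₁, y₁, hy₁⟩ := exists_isMaxMat_input (As := As) hy₀
  obtain ⟨M₂, hM₂⟩ := exists_isMaxMat (edgesX As ∪ edgesU B ∪ edgesN As B)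
  -- `Q` keeps the right ends of `M₁`, hence the number of X ∪ U edges and the input, and the left
  -- ends of `M₂`, hence the total number of edges.
  obtain ⟨Q, hQ, hmat, hQ2, hQ1⟩ := hM₁.2.1.exists_cover hM₂.2.1
  have hQsub : Q ⊆ edgesX As ∪ edgesU B ∪ edgesN As B :=
    hQ.trans (Finset.union_subset (hM₁.1.trans Finset.subset_union_left) hM₂.1)
  -- The right end decides the class: an edge of `Q` ending at a state or at the input is not in N.
  have hXU : ∀ e ∈ M₁, ∃ f ∈ Q ∩ (edgesX As ∪ edgesU B), f.2 = e.2 := by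
    intro e he
    obtain ⟨f, hf, hfe⟩ := hQ1 e he
    refine ⟨f, Finset.mem_inter.2 ⟨hf, ?_⟩, hfe⟩
    have h1 := hM₁.1 he
    have h2 := hQsub hf
    obtain ⟨y, r⟩ := e
    obtain ⟨z, r'⟩ := f
    simp only at hfe
    subst hfe
    rcases r' with x | u | S
    · simpa using h2
    · simpa using h2
    · simp at h1
  have hQXU : IsMaxMat (edgesX As ∪ edgesU B) (Q ∩ (edgesX As ∪ edgesU B)) := by
    refine hM₁.of_card_le Finset.inter_subset_right (hmat.subset Finset.inter_subset_left) ?_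
    rw [← hM₁.2.1.card_image_snd, ← (hmat.subset Finset.inter_subset_left).card_image_snd]
    apply Finset.card_le_card
    intro r hr
    obtain ⟨e, he, rfl⟩ := Finset.mem_image.1 hr
    obtain ⟨f, hf, hfe⟩ := hXU e he
    exact Finset.mem_image.2 ⟨f, hf, hfe⟩
  have hQmax : IsMaxMat (edgesX As ∪ edgesU B ∪ edgesN As B) Q := by
    refine hM₂.of_card_le hQsub hmat ?_
    rw [← hM₂.2.1.card_image_fst, ← hmat.card_image_fst]
    apply Finset.card_le_card
    intro r hr
    obtain ⟨e, he, rfl⟩ := Finset.mem_image.1 hr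
    obtain ⟨f, hf, hfe⟩ := hQ2 e he
    exact Finset.mem_image.2 ⟨f, hf, hfe⟩
  obtain ⟨K, hK, hmatK, hcard, -, -⟩ := exists_completion hfull hQsub hmat hQXU
  have hKI : ∀ e ∈ K, e ∉ edgesX As ∪ edgesU B ∪ edgesN As B :=
    fun e he h => disjoint_edgesI h (hK he)
  have e1 : (Q ∪ K) ∩ (edgesX As ∪ edgesU B) = Q ∩ (edgesX As ∪ edgesU B) := by
    ext e
    simp only [Finset.mem_inter, Finset.mem_union]
    have := hKI e
    simp only [Finset.mem_union] at this
    tauto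
  have e2 : (Q ∪ K) \ edgesI k n = Q := by
    ext e
    simp only [Finset.mem_sdiff, Finset.mem_union]
    have h1 := @hK e
    have h2 := fun h => disjoint_edgesI (@hQsub e h)
    tauto
  refine ⟨Q ∪ K, isPerfectMatching_bipABN.2 ⟨?_, hmatK, hcard⟩, by rwa [e1], by rwa [e2], ?_⟩
  · intro e he
    rcases Finset.mem_union.1 he with h | h
    · have := hQsub h
      simp only [Finset.mem_union] at this ⊢
      tauto
    · have := hK h
      simp only [Finset.mem_union] at this ⊢
      tauto
  · apply le_antisymm hmatK.card_inter_edgesU_le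
    obtain ⟨⟨z, r⟩, hf, hfe⟩ := hXU _ hy₁
    simp only at hfe
    subst hfe
    rw [Nat.one_le_iff_ne_zero, Finset.card_ne_zero]
    obtain ⟨h1, h2⟩ := Finset.mem_inter.1 hf
    refine ⟨_, Finset.mem_inter.2 ⟨Finset.mem_union_left _ h1, ?_⟩⟩
    simpa using h2

theorem exists_isOptimumMatching (hk : 0 < k) (hn : 0 < n)
    (hfull : StructurallyControllable (composite As (allInterconnections k n)) B) :
    ∃ M, IsOptimumMatching As B M := by
  classical
  obtain ⟨M₀, hM₀, -⟩ := exists_best_matching hk hn hfull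
  obtain ⟨M, hM, hmin⟩ := Finset.exists_min_image
    ((bipABN As B).edges.powerset.filter (bipABN As B).IsPerfectMatching)
    (fun M => ∑ e ∈ M, cost e)
    ⟨M₀, Finset.mem_filter.2 ⟨Finset.mem_powerset.2 hM₀.1.1, hM₀⟩⟩
  exact ⟨M, (Finset.mem_filter.1 hM).2, fun M' h => hmin M'
    (Finset.mem_filter.2 ⟨Finset.mem_powerset.2 h.1.1, h⟩)⟩

/-- Some perfect matching attains the three maxima in `sum_cost_add` at once. An optimum matching is
at most as expensive and is bounded by each maximum separately, so it attains all three. -/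
theorem IsOptimumMatching.spec (hk : 0 < k) (hn : 0 < n)
    (hfull : StructurallyControllable (composite As (allInterconnections k n)) B)
    {M : Finset (Edge k n)} (hM : IsOptimumMatching As B M) :
    IsMaxMat (edgesX As ∪ edgesU B) (M ∩ (edgesX As ∪ edgesU B)) ∧
      IsMaxMat (edgesX As ∪ edgesU B ∪ edgesN As B) (M \ edgesI k n) ∧
      ∃ y, (y, RightNode.input 0) ∈ M := by
  obtain ⟨M₀, hM₀, h1, h2, h3⟩ :
      ∃ M₀ : Finset (Edge k n), _ := exists_best_matching (As := As) (B := B) hk hn hfull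
  have hle : ∑ e ∈ M, cost e ≤ ∑ e ∈ M₀, cost e := hM.2 M₀ hM₀
  obtain ⟨hs, hmat, hc⟩ := isPerfectMatching_bipABN.1 hM.1
  obtain ⟨hs₀, hmat₀, hc₀⟩ := isPerfectMatching_bipABN.1 hM₀
  have hcost := sum_cost_add hs
  have hcost₀ := sum_cost_add hs₀
  have hmat1 : IsMat (M ∩ (edgesX As ∪ edgesU B)) := hmat.subset Finset.inter_subset_left
  have hmat2 : IsMat (M \ edgesI k n) := hmat.subset Finset.sdiff_subset
  have i1 := h1.2.2 _ Finset.inter_subset_right hmat1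
  have i2 := h2.2.2 _ (sdiff_edgesI_subset hs) hmat2
  have i3 := hmat.card_inter_edgesU_le (B := B)
  rw [hc] at hcost
  rw [hc₀] at hcost₀
  refine ⟨h1.of_card_le Finset.inter_subset_right hmat1 (by omega),
    h2.of_card_le (sdiff_edgesI_subset hs) hmat2 (by omega), ?_⟩
  have hne : (M ∩ edgesU B).card ≠ 0 := by omega
  rw [Finset.card_ne_zero] at hne
  obtain ⟨⟨y, x | u | S⟩, he⟩ := hne
  · simp at he
  · rw [Subsingleton.elim u 0] at he
    exact ⟨y, (Finset.mem_inter.1 he).1⟩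
  · simp at he

end Optimum

/-! ### Accessibility -/

section Access

variable {k n : ℕ} {As : Matrix (Fin n) (Fin n) Bool} {B : Matrix (State k n) (Fin 1) Bool}
  {F F' : Finset (State k n × State k n)}

theorem Accessible.of_input {y : State k n} (hy : B y 0 = true) : Accessible As B F y :=
  ⟨0, Relation.ReflTransGen.single hy⟩

theorem Accessible.step {x y : State k n} (hx : Accessible As B F x)
    (hxy : localAdj As x y ∨ (x, y) ∈ F) : Accessible As B F y := by
  obtain ⟨u, hu⟩ := hx
  exact ⟨u, hu.tail hxy⟩

theorem Accessible.induction {p : State k n → Prop} (hin : ∀ y, B y 0 = true → p y)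
    (hstep : ∀ x y, Accessible As B F x → p x → (localAdj As x y ∨ (x, y) ∈ F) → p y)
    {x : State k n} (hx : Accessible As B F x) : p x := by
  obtain ⟨u, hu⟩ := hx
  suffices H : ∀ a, Relation.ReflTransGen (sysAdj As B F) (.inr u) a → ∀ x, a = .inl x → p x from
    H _ hu x rfl
  intro a ha
  induction ha with
  | refl => intro x h; cases h
  | @tail b c hb hbc ih =>
    rintro x rfl
    rcases b with b | v
    · exact hstep b x ⟨u, hb⟩ (ih b rfl) hbc
    · rw [Subsingleton.elim v 0] at hbc
      exact hin x hbc

/-- Only links with an accessible tail matter, and such a link may be dropped if its head is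
accessible anyway. This is what makes redirecting links harmless. -/
theorem Accessible.transfer
    (h : ∀ x y, (x, y) ∈ F → Accessible As B F x → (x, y) ∈ F' ∨ Accessible As B F' y)
    {x : State k n} (hx : Accessible As B F x) : Accessible As B F' x := by
  refine hx.induction (fun y hy => .of_input hy) ?_
  rintro x y hx hx' (hl | hl)
  · exact hx'.step (Or.inl hl)
  · rcases h x y hl hx with h | h
    · exact hx'.step (Or.inr h)
    · exact h

theorem Accessible.mono (h : F ⊆ F') {x : State k n} (hx : Accessible As B F x) :
    Accessible As B F' x :=
  hx.transfer fun _ _ hxy _ => Or.inl (h hxy)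

theorem SetAccessible.mono (h : F ⊆ F') {S : Finset (State k n)} (hS : SetAccessible As B F S) :
    SetAccessible As B F' S :=
  fun x hx => (hS x hx).mono h

theorem Accessible.of_local {x y : State k n} (hx : Accessible As B F x)
    (hxy : Relation.ReflTransGen (localAdj As) x y) : Accessible As B F y := by
  induction hxy with
  | refl => exact hx
  | tail _ h ih => exact ih.step (Or.inl h)

theorem fst_eq_of_local {x y : State k n} (hxy : Relation.ReflTransGen (localAdj As) x y) :
    x.1 = y.1 := by
  induction hxy with
  | refl => rfl
  | tail _ h ih => exact ih.trans h.1

/-! ### Components without incoming edges -/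

theorem local_of_mem {S : Finset (State k n)} (hS : IsSCC (localAdj As) S) {x y : State k n}
    (hx : x ∈ S) (hy : y ∈ S) : Relation.ReflTransGen (localAdj As) x y := by
  obtain ⟨z, hz⟩ := hS
  exact ((hz x).1 hx).2.trans ((hz y).1 hy).1

theorem SetAccessible.of_mem {S : Finset (State k n)} (hS : IsSCC (localAdj As) S) {x : State k n}
    (hx : x ∈ S) (hacc : Accessible As B F x) : SetAccessible As B F S :=
  fun _ hy => hacc.of_local (local_of_mem hS hx hy)

theorem mem_inaccessibleSCCs {S : Finset (State k n)} :
    S ∈ inaccessibleSCCs As B ↔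
      IsSCC (localAdj As) S ∧ NonTopLinked (localAdj As) S ∧ ¬ SetAccessible As B ∅ S := by
  simp [inaccessibleSCCs]

theorem scc_nonempty {S : Finset (State k n)} (hS : IsSCC (localAdj As) S) : S.Nonempty := by
  obtain ⟨z, hz⟩ := hS
  exact ⟨z, (hz z).2 ⟨.refl, .refl⟩⟩

theorem scc_eq {S S' : Finset (State k n)} (hS : IsSCC (localAdj As) S)
    (hS' : IsSCC (localAdj As) S') {x : State k n} (hx : x ∈ S) (hx' : x ∈ S') : S = S' := by
  obtain ⟨z, hz⟩ := id hS
  obtain ⟨z', hz'⟩ := id hS'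
  ext y
  constructor
  · intro hy
    exact (hz' y).2 ⟨((hz' x).1 hx').1.trans (local_of_mem hS hx hy),
      (local_of_mem hS hy hx).trans ((hz' x).1 hx').2⟩
  · intro hy
    exact (hz y).2 ⟨((hz x).1 hx).1.trans (local_of_mem hS' hx' hy),
      (local_of_mem hS' hy hx').trans ((hz x).1 hx).2⟩

/-- An inaccessible component becomes accessible only through an entering interconnection. -/
theorem not_accessible_of_not_entered {S : Finset (State k n)} (hS : S ∈ inaccessibleSCCs As B)
    (hF : ∀ x y, (x, y) ∈ F → y ∉ S) {x : State k n} (hx : x ∈ S) : ¬ Accessible As B F x := by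
  obtain ⟨h1, h2, h3⟩ := mem_inaccessibleSCCs.1 hS
  intro hacc
  refine hacc.induction (p := fun y => y ∉ S) ?_ ?_ hx
  · intro y hy hyS
    exact h3 (SetAccessible.of_mem h1 hyS (.of_input hy))
  · rintro x y - hxS (h | h)
    · exact fun hy => h2 x y hxS hy h
    · exact hF x y h

/-- Every state is reached, within its subsystem, from a component without incoming edges. -/
theorem exists_source (y : State k n) :
    ∃ S : Finset (State k n), IsSCC (localAdj As) S ∧ NonTopLinked (localAdj As) S ∧
      ∃ w ∈ S, Relation.ReflTransGen (localAdj As) w y := by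
  classical
  let pred : State k n → Finset (State k n) := fun w =>
    Finset.univ.filter fun z => Relation.ReflTransGen (localAdj As) z w
  have hpred : ∀ z w, z ∈ pred w ↔ Relation.ReflTransGen (localAdj As) z w := by simp [pred]
  -- Among the predecessors of `y`, one with fewest predecessors: any predecessor of `w` then has
  -- the same predecessors as `w`, so `w` reaches it back.
  obtain ⟨w, hw, hmin⟩ := Finset.exists_min_image (pred y) (fun w => (pred w).card)
    ⟨y, (hpred _ _).2 .refl⟩
  rw [hpred] at hw
  have hback : ∀ z, Relation.ReflTransGen (localAdj As) z w →
      Relation.ReflTransGen (localAdj As) w z := by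
    intro z hz
    have hsub : pred z ⊆ pred w := fun a ha => (hpred _ _).2 (((hpred _ _).1 ha).trans hz)
    have := Finset.eq_of_subset_of_card_le hsub (hmin z ((hpred _ _).2 (hz.trans hw)))
    exact (hpred _ _).1 (this ▸ (hpred w w).2 .refl)
  refine ⟨pred w, ⟨w, fun z => ?_⟩, ?_, w, (hpred _ _).2 .refl, hw⟩
  · rw [hpred]
    exact ⟨fun h => ⟨hback z h, h⟩, fun h => h.2⟩
  · intro x z hx hz h
    exact hx ((hpred _ _).2 (Relation.ReflTransGen.head h ((hpred _ _).1 hz)))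

/-- Each state lies downstream of a component without incoming edges, which is accessible either
without links or by hypothesis. -/
theorem accessible_of_setAccessible (hF : ∀ S ∈ inaccessibleSCCs As B, SetAccessible As B F S)
    (y : State k n) : Accessible As B F y := by
  obtain ⟨S, h1, h2, w, hw, hwy⟩ := exists_source (As := As) y
  refine Accessible.of_local ?_ hwy
  by_cases h : SetAccessible As B ∅ S
  · exact (h w hw).mono (Finset.empty_subset _)
  · exact hF S (mem_inaccessibleSCCs.2 ⟨h1, h2, h⟩) w hw

/-! ### Interconnections used by a matching -/

theorem mem_allInterconnections {x y : State k n} :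
    (x, y) ∈ allInterconnections k n ↔ x.1 ≠ y.1 := by
  simp [allInterconnections]

theorem mem_usedLinks {M : Finset (Edge k n)} {x y : State k n} :
    (x, y) ∈ usedLinks M ↔ x.1 ≠ y.1 ∧ (y, RightNode.state x) ∈ M := by
  simp [usedLinks, mem_allInterconnections]

theorem mem_linkEdges {x y : State k n} :
    (y, RightNode.state x) ∈ linkEdges F ↔ (x, y) ∈ F := by
  simp only [linkEdges, Finset.mem_image, Prod.mk.injEq, RightNode.state.injEq]
  constructor
  · rintro ⟨⟨a, b⟩, h, rfl, rfl⟩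
    exact h
  · exact fun h => ⟨(x, y), h, rfl, rfl⟩

theorem usedLinks_subset (M : Finset (Edge k n)) : usedLinks M ⊆ allInterconnections k n :=
  Finset.filter_subset _ _

theorem card_usedLinks (M : Finset (Edge k n)) :
    (usedLinks M).card = (M ∩ edgesI k n).card := by
  rw [← Finset.card_image_of_injective (f := fun e : State k n × State k n =>
    ((e.2, RightNode.state e.1) : Edge k n)) (usedLinks M) (by
      rintro ⟨a, b⟩ ⟨c, d⟩ h
      simp only [Prod.mk.injEq, RightNode.state.injEq] at h
      rw [h.1, h.2])]
  congr 1
  ext ⟨y, r⟩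
  constructor
  · intro h
    obtain ⟨⟨a, b⟩, hab, h⟩ := Finset.mem_image.1 h
    rw [mem_usedLinks] at hab
    rw [← h, Finset.mem_inter]
    exact ⟨hab.2, by simpa using hab.1.symm⟩
  · intro h
    rw [Finset.mem_inter] at h
    rcases r with x | u | S
    · exact Finset.mem_image.2 ⟨(x, y), mem_usedLinks.2
        ⟨by simpa [eq_comm] using h.2, h.1⟩, rfl⟩
    · simp at h
    · simp at h

theorem subset_linkEdges_usedLinks {M : Finset (Edge k n)}
    (hM : M ⊆ edgesX As ∪ edgesI k n ∪ edgesU B) :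
    M ⊆ edgesX As ∪ edgesU B ∪ linkEdges (usedLinks M) := by
  intro e he
  have h := hM he
  obtain ⟨y, x | u | S⟩ := e
  · simp only [Finset.mem_union, mem_linkEdges, mem_usedLinks, state_mem_edgesX, state_mem_edgesI,
      state_notMem_edgesU, or_false] at h ⊢
    rcases h with h | h
    · exact Or.inl h
    · exact Or.inr ⟨h.symm, he⟩
  · simpa [linkEdges] using h
  · simp at h

theorem IsMat.exists_edge {M : Finset (Edge k n)} (hmat : IsMat M) (hcard : M.card = k * n)
    (y : State k n) : ∃ r, (y, r) ∈ M := by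
  have : M.image Prod.fst = Finset.univ := by
    rw [← Finset.card_eq_iff_eq_univ, hmat.card_image_fst, card_state, hcard]
  have hy : y ∈ M.image Prod.fst := this ▸ Finset.mem_univ y
  obtain ⟨⟨z, r⟩, he, rfl⟩ := Finset.mem_image.1 hy
  exact ⟨r, he⟩

/-- A matching with `k * n` edges covers every left node, so it is the injection required by
`structurallyControllable_of_matching`; accessibility of all states supplies the other condition. -/
theorem structurallyControllable_composite {M : Finset (Edge k n)}
    (hF : F ⊆ allInterconnections k n)
    (hM : M ⊆ edgesX As ∪ edgesU B ∪ linkEdges F) (hmat : IsMat M) (hcard : M.card = k * n)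
    (hacc : ∀ S ∈ inaccessibleSCCs As B, SetAccessible As B F S) :
    StructurallyControllable (composite As F) B := by
  choose r hr using hmat.exists_edge hcard
  have hrinj : Function.Injective r := fun y z h =>
    congrArg Prod.fst (hmat.eq_of_snd (hr y) (hr z) h)
  let σ : State k n → Option (State k n) := fun y =>
    match r y with
    | .state x => some x
    | _ => none
  have hσ : ∀ y, (∃ x, r y = .state x ∧ σ y = some x) ∨ (r y = .input 0 ∧ σ y = none) := by
    intro y
    have h := hM (hr y)
    cases hy : r y with
    | state x => exact Or.inl ⟨x, rfl, by simp only [σ, hy]⟩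
    | input u => exact Or.inr ⟨by rw [Subsingleton.elim u 0], by simp only [σ, hy]⟩
    | scc S =>
      rw [hy] at h
      simp [linkEdges] at h
  refine structurallyControllable_of_matching _ _ σ ?_ ?_ ?_ ?_
  · intro y z h
    apply hrinj
    rcases hσ y with ⟨x, h1, h2⟩ | ⟨h1, h2⟩ <;> rcases hσ z with ⟨x', h1', h2'⟩ | ⟨h1', h2'⟩ <;>
      rw [h2, h2'] at h
    · rw [h1, h1', Option.some.inj h]
    · cases h
    · cases h
    · rw [h1, h1']
  · intro y x h
    rcases hσ y with ⟨x', h1, h2⟩ | ⟨h1, h2⟩ <;> rw [h2] at h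
    · rw [Option.some.inj h] at h1
      have h3 := hM (hr y)
      rw [h1] at h3
      simp only [Finset.mem_union, mem_linkEdges, state_mem_edgesX, state_notMem_edgesU,
        or_false] at h3
      rw [composite_eq_true]
      rcases h3 with h3 | h3
      · exact Or.inl ⟨h3.1.symm, h3.2⟩
      · exact Or.inr ⟨mem_allInterconnections.1 (hF h3), h3⟩
    · cases h
  · intro y h
    rcases hσ y with ⟨x', h1, h2⟩ | ⟨h1, h2⟩
    · rw [h2] at h
      cases h
    · have h3 := hM (hr y)
      rw [h1] at h3
      simpa [linkEdges] using h3
  · intro T hin hT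
    rw [Set.eq_univ_iff_forall]
    intro y
    refine (accessible_of_setAccessible hacc y).induction (p := (· ∈ T)) hin ?_
    rintro x y - hx (h | h)
    · exact hT x hx y (composite_eq_true.2 (Or.inl h))
    · exact hT x hx y (composite_eq_true.2 (Or.inr ⟨mem_allInterconnections.1 (hF h), h⟩))

theorem StructurallyControllable.accessible
    (h : StructurallyControllable (composite As F) B) (y : State k n) : Accessible As B F y := by
  have := h.reach {y | Accessible As B F y} (fun y hy => .of_input hy) (by
    intro x hx y hxy
    rcases composite_eq_true.1 hxy with h | h
    · exact Accessible.step hx (Or.inl h)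
    · exact Accessible.step hx (Or.inr h.2))
  have hy : y ∈ {y | Accessible As B F y} := this ▸ Set.mem_univ y
  exact hy

end Access

/-! ### Counting interconnections -/

section Counting

variable {k n : ℕ} {As : Matrix (Fin n) (Fin n) Bool} {B : Matrix (State k n) (Fin 1) Bool}
  {F F' : Finset (State k n × State k n)}

open Classical in
/-- The inaccessible components that are entered by a link in `F`. -/
noncomputable def entered (As : Matrix (Fin n) (Fin n) Bool) (B : Matrix (State k n) (Fin 1) Bool)
    (F : Finset (State k n × State k n)) : Finset (Finset (State k n)) :=
  (inaccessibleSCCs As B).filter fun S => ∃ x y, (x, y) ∈ F ∧ y ∈ S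

theorem mem_entered {S : Finset (State k n)} :
    S ∈ entered As B F ↔ S ∈ inaccessibleSCCs As B ∧ ∃ x y, (x, y) ∈ F ∧ y ∈ S := by
  simp only [entered, Finset.mem_filter]

theorem entered_subset : entered As B F ⊆ inaccessibleSCCs As B :=
  fun _ hS => (mem_entered.1 hS).1

theorem entered_mono (h : F ⊆ F') : entered As B F ⊆ entered As B F' := by
  intro S hS
  obtain ⟨h1, x, y, h2, h3⟩ := mem_entered.1 hS
  exact mem_entered.2 ⟨h1, x, y, h h2, h3⟩

theorem mem_entered_of_setAccessible {S : Finset (State k n)} (hS : S ∈ inaccessibleSCCs As B)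
    (hacc : SetAccessible As B F S) : S ∈ entered As B F := by
  by_contra h
  obtain ⟨x, hx⟩ := scc_nonempty (mem_inaccessibleSCCs.1 hS).1
  exact not_accessible_of_not_entered hS
    (fun a b hab hb => h (mem_entered.2 ⟨hS, a, b, hab, hb⟩)) hx (hacc x hx)

theorem inaccessibleSCCs_eq {S S' : Finset (State k n)} (hS : S ∈ inaccessibleSCCs As B)
    (hS' : S' ∈ inaccessibleSCCs As B) {x : State k n} (hx : x ∈ S) (hx' : x ∈ S') : S = S' :=
  scc_eq (mem_inaccessibleSCCs.1 hS).1 (mem_inaccessibleSCCs.1 hS').1 hx hx'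

/-- Each component entered by a link of a matching can be matched in place of such a link. -/
theorem IsMaxMat.card_add_card_entered_le {M Q : Finset (Edge k n)}
    (hQ : IsMaxMat (edgesX As ∪ edgesU B ∪ edgesN As B) Q) (hM : IsMat M) :
    (M ∩ (edgesX As ∪ edgesU B)).card + (entered As B (usedLinks M)).card ≤ Q.card := by
  have hex : ∀ S : entered As B (usedLinks M), ∃ y, y ∈ S.1 ∧ ∃ x, (x, y) ∈ usedLinks M := by
    rintro ⟨S, h⟩
    obtain ⟨_, x, y, h1, h2⟩ := mem_entered.1 h
    exact ⟨y, h2, x, h1⟩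
  choose y hy x hx using hex
  -- For each entered component, an N edge at the head of a link of `M` entering it. This head is
  -- matched in `M` by an interconnection, so it is free once only the X ∪ U edges of `M` are kept.
  set N : Finset (Edge k n) :=
    Finset.univ.image fun S : entered As B (usedLinks M) => (y S, RightNode.scc S.1) with hN
  have hNcard : N.card = (entered As B (usedLinks M)).card := by
    rw [hN, Finset.card_image_of_injective, Finset.card_univ, Fintype.card_coe]
    rintro ⟨S, _⟩ ⟨S', _⟩ h
    exact Subtype.ext (RightNode.scc.inj (Prod.mk.inj h).2)
  have hNmat : IsMat N := by
    apply isMat_of_eq <;> intro a ha b hb hab <;>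
      obtain ⟨S, -, rfl⟩ := Finset.mem_image.1 ha <;> obtain ⟨S', -, rfl⟩ := Finset.mem_image.1 hb
    · have : S = S' := Subtype.ext (inaccessibleSCCs_eq (entered_subset S.2) (entered_subset S'.2)
        (hy S) (by simp only at hab; rw [hab]; exact hy S'))
      rw [this]
    · have : S = S' := Subtype.ext (RightNode.scc.inj hab)
      rw [this]
  have h1 : ∀ e ∈ M ∩ (edgesX As ∪ edgesU B), ∀ f ∈ N, e.1 ≠ f.1 := by
    intro e he f hf h
    obtain ⟨S, -, rfl⟩ := Finset.mem_image.1 hf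
    obtain ⟨h2, h3⟩ := Finset.mem_inter.1 he
    obtain ⟨h4, h5⟩ := mem_usedLinks.1 (hx S)
    have h6 := hM.eq_of_fst h2 h5 h
    rw [h6] at h3
    simp only [Finset.mem_union, state_mem_edgesX, state_notMem_edgesU, or_false] at h3
    exact h4 h3.1.symm
  have h2 : ∀ e ∈ M ∩ (edgesX As ∪ edgesU B), ∀ f ∈ N, e.2 ≠ f.2 := by
    intro e he f hf h
    obtain ⟨S, -, rfl⟩ := Finset.mem_image.1 hf
    obtain ⟨h2, h3⟩ := Finset.mem_inter.1 he
    obtain ⟨z, r⟩ := e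
    simp only at h
    subst h
    simp at h3
  have hle := hQ.2.2 (M ∩ (edgesX As ∪ edgesU B) ∪ N) (by
    apply Finset.union_subset_union Finset.inter_subset_right
    intro f hf
    obtain ⟨S, -, rfl⟩ := Finset.mem_image.1 hf
    rw [scc_mem_edgesN]
    exact ⟨entered_subset S.2, hy S⟩)
    ((hM.subset Finset.inter_subset_left).union hNmat h1 h2)
  rwa [Finset.card_union_of_disjoint (Finset.disjoint_left.2 fun e he hf => h1 e he e hf rfl),
    hNcard] at hle

/-- Links that make all components accessible contain, besides given links `F'`, one link for each
component that is not entered by `F'`. -/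
theorem card_add_card_le_of_accessible (hF' : F' ⊆ F)
    (hacc : ∀ S ∈ inaccessibleSCCs As B, SetAccessible As B F S) :
    F'.card + (inaccessibleSCCs As B).card ≤ F.card + (entered As B F').card := by
  -- Accessibility forces a link of `F` into `S`, and it is not in `F'`. Distinct components are
  -- disjoint, so the chosen links are distinct.
  have hex : ∀ S : ↥(inaccessibleSCCs As B \ entered As B F'),
      ∃ e : State k n × State k n, e ∈ F \ F' ∧ e.2 ∈ S.1 := by
    rintro ⟨S, hS⟩
    rw [Finset.mem_sdiff] at hS
    obtain ⟨-, x, y, h1, h2⟩ := mem_entered.1 (mem_entered_of_setAccessible hS.1 (hacc S hS.1))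
    exact ⟨(x, y), Finset.mem_sdiff.2
      ⟨h1, fun h => hS.2 (mem_entered.2 ⟨hS.1, x, y, h, h2⟩)⟩, h2⟩
  choose e he heS using hex
  have h1 : (inaccessibleSCCs As B \ entered As B F').card ≤ (F \ F').card := by
    rw [← Fintype.card_coe, ← Finset.card_univ]
    refine Finset.card_le_card_of_injOn e (fun S _ => he S) ?_
    intro S _ S' _ h
    exact Subtype.ext (inaccessibleSCCs_eq (Finset.mem_sdiff.1 S.2).1 (Finset.mem_sdiff.1 S'.2).1
      (heS S) (by rw [h]; exact heS S'))
  rw [Finset.card_sdiff_of_subset entered_subset, Finset.card_sdiff_of_subset hF'] at h1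
  have h2 := Finset.card_le_card hF'
  have h3 := Finset.card_le_card (entered_subset (As := As) (B := B) (F := F'))
  omega

theorem card_eq_card_add_card_usedLinks {M : Finset (Edge k n)}
    (hM : M ⊆ edgesX As ∪ edgesI k n ∪ edgesU B) :
    M.card = (M ∩ (edgesX As ∪ edgesU B)).card + (usedLinks M).card := by
  rw [card_usedLinks, ← Finset.card_union_of_disjoint]
  · congr 1
    ext e
    have := @hM e
    simp only [Finset.mem_union, Finset.mem_inter] at this ⊢
    tauto
  · rw [Finset.disjoint_left]
    intro e he hf
    rw [Finset.mem_inter] at he hf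
    exact disjoint_edgesI (Finset.mem_union_left _ he.2) hf.2

/-- The lower bound on the number of interconnections. -/
theorem card_le_of_structurallyControllable {Q : Finset (Edge k n)}
    (hQ : IsMaxMat (edgesX As ∪ edgesU B ∪ edgesN As B) Q)
    (hF : F ⊆ allInterconnections k n)
    (h : StructurallyControllable (composite As F) B) :
    k * n + (inaccessibleSCCs As B).card ≤ F.card + Q.card := by
  obtain ⟨M, hM, hmat, hcard⟩ := exists_matching_of_structurallyControllable h
  have hMI : M ⊆ edgesX As ∪ edgesI k n ∪ edgesU B := by
    intro e he
    have h1 := hM he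
    have h2 := @linkEdges_subset _ _ _ hF e
    simp only [Finset.mem_union] at h1 ⊢
    tauto
  have hsub : usedLinks M ⊆ F := by
    rintro ⟨x, y⟩ hxy
    obtain ⟨h1, h2⟩ := mem_usedLinks.1 hxy
    have h3 := hM h2
    simp only [Finset.mem_union, mem_linkEdges, state_mem_edgesX, state_notMem_edgesU,
      or_false] at h3
    exact h3.resolve_left fun h4 => h1 h4.1.symm
  -- Adding up `h1`, `h2`, `h3`, the X ∪ U edges, the used links and the entered components of `M`
  -- all cancel.
  have h1 := card_eq_card_add_card_usedLinks hMI
  have h2 := hQ.card_add_card_entered_le hmat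
  have h3 := card_add_card_le_of_accessible (As := As) (B := B) hsub
    (fun S _ x _ => h.accessible x)
  omega

/-! ### Structured matrices and their interconnections -/

theorem interconnections_composite (hF : F ⊆ allInterconnections k n) :
    interconnections (composite As F) = F := by
  ext ⟨x, y⟩
  unfold interconnections
  rw [Finset.mem_filter, mem_allInterconnections, composite_eq_true]
  constructor
  · rintro ⟨h1, h2 | h2⟩
    · exact absurd h2.1 h1
    · exact h2.2
  · intro h
    have := mem_allInterconnections.1 (hF h)
    exact ⟨this, Or.inr ⟨this, h⟩⟩

theorem interconnections_subset (P : Matrix (State k n) (State k n) Bool) :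
    interconnections P ⊆ allInterconnections k n :=
  Finset.filter_subset _ _

theorem composite_interconnections {P : Matrix (State k n) (State k n) Bool}
    (hP : ∀ i p q, P (i, p) (i, q) = As p q) : composite As (interconnections P) = P := by
  ext ⟨i, p⟩ ⟨j, q⟩
  by_cases h : i = j
  · subst h
    simp [composite, hP]
  · have h' : j ≠ i := fun h' => h h'.symm
    simp [composite, h, interconnections, mem_allInterconnections, h']

theorem zeroNorm_eq {P : Matrix (State k n) (State k n) Bool}
    (hP : ∀ i p q, P (i, p) (i, q) = As p q) :
    zeroNorm P = (edgesX As : Finset (Edge k n)).card + (interconnections P).card := by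
  unfold zeroNorm
  rw [← Finset.card_filter_add_card_filter_not (fun e : State k n × State k n => e.1.1 = e.2.1)]
  congr 1
  · unfold edgesX
    rw [Finset.card_image_of_injective _ (by
      rintro ⟨a, b⟩ ⟨c, d⟩ h
      simp only [Prod.mk.injEq, RightNode.state.injEq] at h
      rw [h.1, h.2]), Finset.filter_filter]
    congr 1
    ext ⟨⟨i, p⟩, ⟨j, q⟩⟩
    simp only [Finset.mem_filter, Finset.mem_univ, true_and]
    constructor
    · rintro ⟨h1, rfl⟩
      exact ⟨rfl, (hP _ _ _).symm.trans h1⟩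
    · rintro ⟨rfl, h1⟩
      exact ⟨(hP _ _ _).trans h1, rfl⟩
  · rw [← Finset.card_map (Equiv.prodComm _ _).toEmbedding]
    congr 1
    ext ⟨x, y⟩
    simp only [Finset.mem_map_equiv, interconnections, Finset.mem_filter, mem_allInterconnections,
      Finset.mem_univ, true_and, Equiv.prodComm_symm, Equiv.prodComm_apply, Prod.swap]
    rw [and_comm]
    exact and_congr_left fun _ => ⟨fun h h' => h h'.symm, fun h h' => h h'.symm⟩

theorem isOptimalSolution_iff {P : Matrix (State k n) (State k n) Bool} :
    IsOptimalSolution As B P ↔ P ∈ feasible As B ∧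
      ∀ P' ∈ feasible As B, (interconnections P).card ≤ (interconnections P').card := by
  unfold IsOptimalSolution
  refine and_congr_right fun hP => forall₂_congr fun P' hP' => ?_
  rw [zeroNorm_eq hP.1, zeroNorm_eq hP'.1]
  exact Nat.add_le_add_iff_left

theorem composite_mem_feasible (h : StructurallyControllable (composite As F) B) :
    composite As F ∈ feasible As B :=
  ⟨fun i p q => by simp [composite], h⟩

/-- `hcard` says that `F` attains the lower bound `card_le_of_structurallyControllable`. -/
theorem isOptimalSolution_composite {Q : Finset (Edge k n)}
    (hQ : IsMaxMat (edgesX As ∪ edgesU B ∪ edgesN As B) Q)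
    (hF : F ⊆ allInterconnections k n)
    (h : StructurallyControllable (composite As F) B)
    (hcard : F.card + Q.card = k * n + (inaccessibleSCCs As B).card) :
    IsOptimalSolution As B (composite As F) ∧
      ∀ P, IsOptimalSolution As B P → (interconnections P).card = F.card := by
  have hlow : ∀ P ∈ feasible As B, F.card ≤ (interconnections P).card := by
    intro P hP
    have := card_le_of_structurallyControllable hQ (interconnections_subset P)
      (by rw [composite_interconnections hP.1]; exact hP.2)
    omega
  constructor
  · rw [isOptimalSolution_iff, interconnections_composite hF]
    exact ⟨composite_mem_feasible h, hlow⟩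
  · intro P hP
    rw [isOptimalSolution_iff] at hP
    have h1 := hP.2 _ (composite_mem_feasible h)
    rw [interconnections_composite hF] at h1
    exact le_antisymm h1 (hlow P hP.1)

end Counting

/-! ### Invariants of the algorithm -/

section Invariants

variable {k n : ℕ} {As : Matrix (Fin n) (Fin n) Bool} {B : Matrix (State k n) (Fin 1) Bool}

/-- Deleting the nodes of `M` removes equally many on both sides; the right side had one node more,
so the left side stays the smaller one. -/
theorem isPerfectMatching_minus {M K : Finset (Edge k n)} (hM : M ⊆ edgesX As ∪ edgesU B)
    (hmat : IsMat M) :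
    ((bipAB As B).minus M).IsPerfectMatching K ↔
      (K ⊆ edgesX As ∪ edgesI k n ∪ edgesU B ∧ (∀ e ∈ M, ∀ f ∈ K, e.1 ≠ f.1) ∧
        ∀ e ∈ M, ∀ f ∈ K, e.2 ≠ f.2) ∧ IsMat K ∧ M.card + K.card = k * n := by
  have hle : M.card ≤ k * n := by
    rw [← hmat.card_image_fst, ← card_state (k := k) (n := n)]
    exact Finset.card_le_univ _
  have hmin : min ((bipAB As B).minus M).left.card ((bipAB As B).minus M).right.card =
      k * n - M.card := by
    have hl : ((bipAB As B).minus M).left.card = k * n - M.card := by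
      simp only [BipGraph.minus, bipAB]
      rw [Finset.card_sdiff_of_subset (Finset.subset_univ _), hmat.card_image_fst,
        Finset.card_univ, card_state]
    have hr : ((bipAB As B).minus M).right.card = k * n + 1 - M.card := by
      simp only [BipGraph.minus, bipAB]
      rw [Finset.card_sdiff_of_subset, hmat.card_image_snd, card_systemNodes]
      intro r hr
      obtain ⟨e, he, rfl⟩ := Finset.mem_image.1 hr
      have he' : e ∈ (bipAB As B).edges := by
        have := hM he
        simp only [bipAB, Finset.mem_union] at this ⊢
        tauto
      exact (Finset.mem_product.1 ((bipAB As B).edges_subset he')).2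
    omega
  unfold BipGraph.IsPerfectMatching BipGraph.IsMatching
  rw [hmin, and_assoc]
  have hedges : K ⊆ ((bipAB As B).minus M).edges ↔
      K ⊆ edgesX As ∪ edgesI k n ∪ edgesU B ∧ (∀ e ∈ M, ∀ f ∈ K, e.1 ≠ f.1) ∧
        ∀ e ∈ M, ∀ f ∈ K, e.2 ≠ f.2 := by
    constructor
    · intro h
      refine ⟨fun f hf => (Finset.mem_filter.1 (h hf)).1, fun e he f hf hef => ?_,
        fun e he f hf hef => ?_⟩
      · exact (Finset.mem_filter.1 (h hf)).2.1 (Finset.mem_image.2 ⟨e, he, hef⟩)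
      · exact (Finset.mem_filter.1 (h hf)).2.2 (Finset.mem_image.2 ⟨e, he, hef⟩)
    · rintro ⟨h1, h2, h3⟩ f hf
      refine Finset.mem_filter.2 ⟨h1 hf, fun h => ?_, fun h => ?_⟩
      · obtain ⟨e, he, hef⟩ := Finset.mem_image.1 h
        exact h2 e he f hf hef
      · obtain ⟨e, he, hef⟩ := Finset.mem_image.1 h
        exact h3 e he f hf hef
  rw [hedges]
  refine and_congr_right fun _ => and_congr_right fun _ => ?_
  omega

/-- A perfect matching of the system bipartite graph that agrees with the optimum matching `M₀`
inside the subsystems and at the input. -/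
structure Extends (As : Matrix (Fin n) (Fin n) Bool) (B : Matrix (State k n) (Fin 1) Bool)
    (M₀ M : Finset (Edge k n)) : Prop where
  optimum : IsOptimumMatching As B M₀
  subset : M ⊆ edgesX As ∪ edgesI k n ∪ edgesU B
  isMat : IsMat M
  card_eq : M.card = k * n
  inter_eq : M ∩ (edgesX As ∪ edgesU B) = M₀ ∩ (edgesX As ∪ edgesU B)

theorem Extends.of_minus (hk : 0 < k) (hn : 0 < n)
    (hfull : StructurallyControllable (composite As (allInterconnections k n)) B)
    {M₀ K : Finset (Edge k n)} (hM₀ : IsOptimumMatching As B M₀)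
    (hK : ((bipAB As B).minus (M₀ ∩ (edgesX As ∪ edgesU B))).IsPerfectMatching K) :
    Extends As B M₀ (M₀ ∩ (edgesX As ∪ edgesU B) ∪ K) := by
  obtain ⟨h1, -, -⟩ := hM₀.spec hk hn hfull
  obtain ⟨⟨hKs, hd1, hd2⟩, hKm, hKc⟩ := (isPerfectMatching_minus h1.1 h1.2.1).1 hK
  have hmat := h1.2.1.union hKm hd1 hd2
  refine ⟨hM₀, ?_, hmat, ?_, ?_⟩
  · apply Finset.union_subset _ hKs
    intro e he
    have := (Finset.mem_inter.1 he).2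
    simp only [Finset.mem_union] at this ⊢
    tauto
  · rw [Finset.card_union_of_disjoint (Finset.disjoint_left.2 fun e he hf => hd1 e he e hf rfl),
      hKc]
  -- The completing edges could belong to X ∪ U, but this would contradict the maximality of the X ∪
  -- U part of `M₀`.
  · symm
    apply Finset.eq_of_subset_of_card_le
    · exact Finset.subset_inter Finset.subset_union_left Finset.inter_subset_right
    · exact h1.2.2 _ Finset.inter_subset_right (hmat.subset Finset.inter_subset_left)

theorem exists_isPerfectMatching_minus (hk : 0 < k) (hn : 0 < n)
    (hfull : StructurallyControllable (composite As (allInterconnections k n)) B)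
    {M₀ : Finset (Edge k n)} (hM₀ : IsOptimumMatching As B M₀) :
    ∃ K, ((bipAB As B).minus (M₀ ∩ (edgesX As ∪ edgesU B))).IsPerfectMatching K := by
  obtain ⟨h1, -, -⟩ := hM₀.spec hk hn hfull
  obtain ⟨K, hK, hmat, hcard, hd1, hd2⟩ := exists_completion hfull
    (h1.1.trans Finset.subset_union_left) h1.2.1
    (by rw [Finset.inter_assoc, Finset.inter_self]; exact h1)
  refine ⟨K, (isPerfectMatching_minus h1.1 h1.2.1).2
    ⟨⟨?_, hd1, hd2⟩, hmat.subset Finset.subset_union_right, ?_⟩⟩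
  · intro e he
    have := hK he
    simp only [Finset.mem_union]
    tauto
  · rwa [← Finset.card_union_of_disjoint
      (Finset.disjoint_left.2 fun e he hf => hd1 e he e hf rfl)]

theorem Extends.input_mem (hk : 0 < k) (hn : 0 < n)
    (hfull : StructurallyControllable (composite As (allInterconnections k n)) B)
    {M₀ M : Finset (Edge k n)} (h : Extends As B M₀ M) :
    ∃ y, B y 0 = true ∧ (y, RightNode.input 0) ∈ M := by
  obtain ⟨-, -, y, hy⟩ := h.optimum.spec hk hn hfull
  have hB : B y 0 = true := by
    simpa using (isPerfectMatching_bipABN.1 h.optimum.1).1 hy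
  refine ⟨y, hB, ?_⟩
  have : (y, RightNode.input 0) ∈ M₀ ∩ (edgesX As ∪ edgesU B) :=
    Finset.mem_inter.2 ⟨hy, by simpa using hB⟩
  rw [← h.inter_eq] at this
  exact (Finset.mem_inter.1 this).1

/-- Replacing one interconnection by another with the same target. -/
theorem Extends.replace {M₀ M : Finset (Edge k n)} (h : Extends As B M₀ M) {s r z : State k n}
    (hz : (s, RightNode.state z) ∈ M) (hsz : s.1 ≠ z.1) (hsr : s.1 ≠ r.1)
    (hr : ∀ y, (y, RightNode.state r) ∉ M) :
    Extends As B M₀ (insert (s, RightNode.state r) (M.erase (s, RightNode.state z))) := by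
  have hr' : (s, RightNode.state r) ∉ M.erase (s, RightNode.state z) :=
    fun h => hr s (Finset.mem_of_mem_erase h)
  refine ⟨h.optimum, ?_, ?_, ?_, ?_⟩
  · intro e he
    rcases Finset.mem_insert.1 he with rfl | he
    · simp [hsr]
    · exact h.subset (Finset.mem_of_mem_erase he)
  · have h1 : ∀ f ∈ M.erase (s, RightNode.state z),
        (s, RightNode.state r).1 ≠ f.1 ∧ (s, RightNode.state r).2 ≠ f.2 := by
      intro f hf
      obtain ⟨h1, h2⟩ := Finset.mem_erase.1 hf
      refine ⟨fun h3 => h1 (h.isMat.eq_of_fst h2 hz h3.symm), fun h3 => ?_⟩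
      obtain ⟨y, q⟩ := f
      simp only at h3
      subst h3
      exact hr y h2
    intro e he f hf hne
    rcases Finset.mem_insert.1 he with rfl | he <;> rcases Finset.mem_insert.1 hf with rfl | hf
    · exact absurd rfl hne
    · exact h1 f hf
    · exact ⟨(h1 e he).1.symm, (h1 e he).2.symm⟩
    · exact h.isMat e (Finset.mem_of_mem_erase he) f (Finset.mem_of_mem_erase hf) hne
  · rw [Finset.card_insert_of_notMem hr', Finset.card_erase_of_mem hz, ← h.card_eq]
    have := Finset.card_pos.2 ⟨_, hz⟩
    omega
  · rw [← h.inter_eq]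
    ext e
    simp only [Finset.mem_inter, Finset.mem_insert, Finset.mem_erase]
    constructor
    · rintro ⟨rfl | h1, h2⟩
      · simp [hsr] at h2
      · exact ⟨h1.2, h2⟩
    · rintro ⟨h1, h2⟩
      refine ⟨Or.inr ⟨?_, h1⟩, h2⟩
      rintro rfl
      simp [hsz] at h2

/-- Any repair, effective or not, trades an interconnection for an interconnection. In the second
case `s` shares its subsystem with `x`, which differs from that of `y` and hence from that of `r`.
-/
theorem Extends.repair {M₀ M M' : Finset (Edge k n)} (h : Extends As B M₀ M) {y : State k n}
    (hy : ToRepair As B M y) (hM' : Repair As B M y M') : Extends As B M₀ M' := by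
  obtain ⟨r, x, hr, hx, hM'⟩ := hM'
  obtain ⟨⟨x', hx'y, hx'⟩, -⟩ := hy
  have hxx : x = x' := RightNode.state.inj (Prod.mk.inj (h.isMat.eq_of_fst hx hx' rfl)).2
  subst hxx
  rcases hM' with ⟨hyr, rfl⟩ | ⟨hyr, s, z, hsx, hzs, hsz, rfl⟩
  · exact h.replace hx hx'y.symm hyr hr.1
  · refine h.replace hsz hzs.symm ?_ hr.1
    rw [hsx, ← hyr]
    exact hx'y

/-- The invariant of the last phase of the algorithm. -/
structure AddInv (As : Matrix (Fin n) (Fin n) Bool) (B : Matrix (State k n) (Fin 1) Bool)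
    (M : Finset (Edge k n)) (F : Finset (State k n × State k n)) : Prop where
  subset : F ⊆ allInterconnections k n
  -- Subtraction-free form: as many links have been added as components newly entered.
  card_eq : (usedLinks M ∪ F).card + (entered As B (usedLinks M)).card =
    (usedLinks M).card + (entered As B (usedLinks M ∪ F)).card
  accessible : ∀ S ∈ entered As B (usedLinks M ∪ F), SetAccessible As B (usedLinks M ∪ F) S

/-- The head of a used link is matched by an interconnection; if its component were inaccessible,
the loop could not have been left. -/
theorem AddInv.of_leave {M : Finset (Edge k n)} (hM : ∀ y, ¬ ToRepair As B M y) :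
    AddInv As B M ∅ := by
  refine ⟨Finset.empty_subset _, by rw [Finset.union_empty, add_comm], ?_⟩
  rw [Finset.union_empty]
  intro S hS
  obtain ⟨h1, x, y, h2, h3⟩ := mem_entered.1 hS
  obtain ⟨h4, h5⟩ := mem_usedLinks.1 h2
  by_contra h
  exact hM y ⟨⟨x, h4, h5⟩, S, h1, h3, h⟩

/-- By the invariant all entered components are accessible, so the inaccessible `S` is not entered
yet. The link is therefore new and enters exactly one more component. -/
theorem AddInv.add {M : Finset (Edge k n)} {F F' : Finset (State k n × State k n)}
    (h : AddInv As B M F) (hF' : AddLink As B M F F') : AddInv As B M F' := by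
  obtain ⟨S, hS, hSacc, y, hy, x, hx, hxy, rfl⟩ := hF'
  have hent : S ∉ entered As B (usedLinks M ∪ F) := fun hS' => hSacc (h.accessible S hS')
  have hnot : (x, y) ∉ usedLinks M ∪ F := fun h' => hent (mem_entered.2 ⟨hS, x, y, h', hy⟩)
  have hG : usedLinks M ∪ insert (x, y) F = insert (x, y) (usedLinks M ∪ F) :=
    Finset.union_insert _ _ _
  have hE : entered As B (insert (x, y) (usedLinks M ∪ F)) =
      insert S (entered As B (usedLinks M ∪ F)) := by
    ext S'
    rw [Finset.mem_insert]
    constructor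
    · intro hS'
      obtain ⟨h1, a, b, h2, h3⟩ := mem_entered.1 hS'
      rcases Finset.mem_insert.1 h2 with h2 | h2
      · obtain ⟨rfl, rfl⟩ := Prod.mk.inj h2
        exact Or.inl (inaccessibleSCCs_eq h1 hS h3 hy)
      · exact Or.inr (mem_entered.2 ⟨h1, a, b, h2, h3⟩)
    · rintro (rfl | hS')
      · exact mem_entered.2 ⟨hS, x, y, Finset.mem_insert_self _ _, hy⟩
      · exact entered_mono (Finset.subset_insert _ _) hS'
  refine ⟨?_, ?_, ?_⟩
  · exact Finset.insert_subset (mem_allInterconnections.2 hxy) h.subset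
  · rw [hG, hE, Finset.card_insert_of_notMem hnot, Finset.card_insert_of_notMem hent]
    have := h.card_eq
    omega
  · rw [hG, hE]
    intro S' hS'
    rcases Finset.mem_insert.1 hS' with rfl | hS'
    · exact SetAccessible.of_mem (mem_inaccessibleSCCs.1 hS).1 hy
        ((hx.mono (Finset.subset_insert _ _)).step (Or.inr (Finset.mem_insert_self _ _)))
    · exact (h.accessible S' hS').mono (Finset.subset_insert _ _)

/-- The components used by the optimum matching are entered by the links of its extensions. -/
theorem Extends.card_le {M₀ M : Finset (Edge k n)} (h : Extends As B M₀ M) :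
    (M₀ \ edgesI k n).card ≤
      (M ∩ (edgesX As ∪ edgesU B)).card + (entered As B (usedLinks M)).card := by
  obtain ⟨hs, hmat, -⟩ := isPerfectMatching_bipABN.1 h.optimum.1
  have h1 : M₀ \ edgesI k n ⊆ (M₀ ∩ (edgesX As ∪ edgesU B)) ∪ (M₀ ∩ edgesN As B) := by
    intro e he
    have h2 := sdiff_edgesI_subset hs he
    have h3 := (Finset.mem_sdiff.1 he).1
    simp only [Finset.mem_union, Finset.mem_inter] at h2 ⊢
    tauto
  have h2 : (M₀ ∩ edgesN As B).card ≤ (entered As B (usedLinks M)).card := by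
    rw [← (hmat.subset Finset.inter_subset_left).card_image_snd,
      ← Finset.card_image_of_injective (f := RightNode.scc (k := k) (n := n))
        (entered As B (usedLinks M)) (fun _ _ h => RightNode.scc.inj h)]
    apply Finset.card_le_card
    intro r hr
    obtain ⟨⟨y, r⟩, he, rfl⟩ := Finset.mem_image.1 hr
    obtain ⟨he1, he2⟩ := Finset.mem_inter.1 he
    rcases r with x | u | S
    · simp at he2
    · simp at he2
    rw [scc_mem_edgesN] at he2
    refine Finset.mem_image.2 ⟨S, ?_, rfl⟩
    obtain ⟨r, hr⟩ := h.isMat.exists_edge h.card_eq y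
    -- `M₀` matches `y` to a component, so `y` is not covered by the common X ∪ U part, and its edge
    -- in `M` is an interconnection entering `S`.
    have hrXU : (y, r) ∉ edgesX As ∪ edgesU B := by
      intro h3
      have h4 : (y, r) ∈ M₀ ∩ (edgesX As ∪ edgesU B) := by
        rw [← h.inter_eq]
        exact Finset.mem_inter.2 ⟨hr, h3⟩
      have h5 := hmat.eq_of_fst (Finset.mem_inter.1 h4).1 he1 rfl
      rw [h5] at h3
      simp at h3
    have h6 := h.subset hr
    rcases r with x | u | S'
    · have h7 : y.1 ≠ x.1 := by
        simp only [Finset.mem_union, state_mem_edgesX, state_mem_edgesI, state_notMem_edgesU,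
          or_false] at h6 hrXU
        exact h6.resolve_left hrXU
      exact mem_entered.2 ⟨he2.1, x, y, mem_usedLinks.2 ⟨h7.symm, hr⟩, he2.2⟩
    · simp only [Finset.mem_union, input_notMem_edgesX, input_notMem_edgesI, false_or] at h6 hrXU
      exact absurd h6 hrXU
    · simp at h6
  calc (M₀ \ edgesI k n).card
      ≤ (M₀ ∩ (edgesX As ∪ edgesU B)).card + (M₀ ∩ edgesN As B).card :=
        (Finset.card_le_card h1).trans (Finset.card_union_le _ _)
    _ ≤ _ := by rw [h.inter_eq]; omega

/-- The number of interconnections in an output. -/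
theorem Extends.card_output (hk : 0 < k) (hn : 0 < n)
    (hfull : StructurallyControllable (composite As (allInterconnections k n)) B)
    {M₀ M : Finset (Edge k n)} {F : Finset (State k n × State k n)}
    (h : Extends As B M₀ M) (hF : AddInv As B M F)
    (hacc : ∀ S ∈ inaccessibleSCCs As B, SetAccessible As B (usedLinks M ∪ F) S) :
    (usedLinks M ∪ F).card + (M₀ \ edgesI k n).card = k * n + (inaccessibleSCCs As B).card := by
  have h1 := hF.card_eq
  have h2 : entered As B (usedLinks M ∪ F) = inaccessibleSCCs As B :=
    Finset.Subset.antisymm entered_subset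
      fun S hS => mem_entered_of_setAccessible hS (hacc S hS)
  have h3 := h.card_le
  have h4 := (h.optimum.spec hk hn hfull).2.1.card_add_card_entered_le h.isMat
  have h5 := card_eq_card_add_card_usedLinks h.subset
  rw [h.card_eq] at h5
  rw [h2] at h1
  omega

/-- The invariant of the algorithm. -/
def Inv (As : Matrix (Fin n) (Fin n) Bool) (B : Matrix (State k n) (Fin 1) Bool) :
    AlgState k n → Prop
  | .start => True
  | .optimum M => IsOptimumMatching As B M
  | .loop M => ∃ M₀, Extends As B M₀ M
  | .selected M y => (∃ M₀, Extends As B M₀ M) ∧ ToRepair As B M y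
  | .adding M F => (∃ M₀, Extends As B M₀ M) ∧ AddInv As B M F
  | .done I => ∃ M F, (∃ M₀, Extends As B M₀ M) ∧ AddInv As B M F ∧
      (∀ S ∈ inaccessibleSCCs As B, SetAccessible As B (usedLinks M ∪ F) S) ∧ I = usedLinks M ∪ F

theorem Inv.of_reachable (hk : 0 < k) (hn : 0 < n)
    (hfull : StructurallyControllable (composite As (allInterconnections k n)) B)
    {ok : State k n → Finset (Edge k n) → Prop} {s : AlgState k n}
    (hs : Reachable As B ok s) : Inv As B s := by
  induction hs with
  | refl => trivial
  | tail _ hstep ih =>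
    cases hstep with
    | findOptimum M hM => exact hM
    | complete M M'' hM => exact ⟨M, Extends.of_minus hk hn hfull ih hM⟩
    | select M y hy => exact ⟨ih, hy⟩
    | repair M y M' hM hok =>
      obtain ⟨⟨M₀, h⟩, hy⟩ := ih
      exact ⟨M₀, h.repair hy hM⟩
    | leave M hM => exact ⟨ih, .of_leave hM⟩
    | add M F F' hF => exact ⟨ih.1, ih.2.add hF⟩
    | output M F hF => exact ⟨M, F, ih.1, ih.2, hF, rfl⟩

/-- Every output is an optimal solution. -/
theorem output_spec (hk : 0 < k) (hn : 0 < n)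
    (hfull : StructurallyControllable (composite As (allInterconnections k n)) B)
    {ok : State k n → Finset (Edge k n) → Prop} {I : Finset (State k n × State k n)}
    (hI : Reachable As B ok (.done I)) :
    I ⊆ allInterconnections k n ∧ IsOptimalSolution As B (composite As I) ∧
      (∀ M, IsOptimumMatching As B M →
        I.card = (M ∩ edgesI k n).card + (inaccessibleSCCs As B).card) ∧
      ∀ P, IsOptimalSolution As B P → (interconnections P).card = I.card := by
  obtain ⟨M, F, ⟨M₀, h⟩, hF, hacc, rfl⟩ := Inv.of_reachable hk hn hfull hI
  have hsub : usedLinks M ∪ F ⊆ allInterconnections k n :=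
    Finset.union_subset (usedLinks_subset M) hF.subset
  have hcard := h.card_output hk hn hfull hF hacc
  have hmax := (h.optimum.spec hk hn hfull).2.1
  have hsc : StructurallyControllable (composite As (usedLinks M ∪ F)) B := by
    refine structurallyControllable_composite hsub ?_ h.isMat h.card_eq hacc
    refine (subset_linkEdges_usedLinks h.subset).trans ?_
    exact Finset.union_subset_union le_rfl (Finset.image_subset_image Finset.subset_union_left)
  obtain ⟨h1, h2⟩ := isOptimalSolution_composite hmax hsub hsc hcard
  refine ⟨hsub, h1, fun M₁ hM₁ => ?_, h2⟩
  -- The non-interconnection parts of two optimum matchings are both maximum, so the number of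
  -- interconnections does not depend on the matching.
  have hmax₁ := (hM₁.spec hk hn hfull).2.1
  have h3 := hmax.2.2 _ hmax₁.1 hmax₁.2.1
  have h4 := hmax₁.2.2 _ hmax.1 hmax.2.1
  have h5 := Finset.card_sdiff_add_card_inter M₁ (edgesI k n)
  rw [(isPerfectMatching_bipABN.1 hM₁.1).2.2] at h5
  omega

end Invariants

/-! ### Progress -/

section Progress

variable {k n : ℕ} {As : Matrix (Fin n) (Fin n) Bool} {B : Matrix (State k n) (Fin 1) Bool}

theorem Extends.cases_edge {M₀ M : Finset (Edge k n)} (h : Extends As B M₀ M) {y : State k n}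
    {r : RightNode k n} (hr : (y, r) ∈ M) :
    (∃ x, r = .state x ∧ (localAdj As x y ∨ (x, y) ∈ usedLinks M)) ∨
      (r = .input 0 ∧ B y 0 = true) := by
  have h1 := h.subset hr
  rcases r with x | u | S
  · left
    simp only [Finset.mem_union, state_mem_edgesX, state_mem_edgesI, state_notMem_edgesU,
      or_false] at h1
    refine ⟨x, rfl, ?_⟩
    rcases h1 with h1 | h1
    · exact Or.inl ⟨h1.1.symm, h1.2⟩
    · exact Or.inr (mem_usedLinks.2 ⟨Ne.symm h1, hr⟩)
  · right
    rw [Subsingleton.elim u 0] at h1 ⊢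
    exact ⟨rfl, by simpa using h1⟩
  · simp at h1

/-- If every accessible state were matched on the right, sending it to its partner on the left would
be an injective self-map of the accessible states, hence surjective. But the state matched with the
input is accessible and is not in the image. -/
theorem Extends.exists_unmatchedAccessible (hk : 0 < k) (hn : 0 < n)
    (hfull : StructurallyControllable (composite As (allInterconnections k n)) B)
    {M₀ M : Finset (Edge k n)} (h : Extends As B M₀ M) :
    ∃ r, UnmatchedAccessible As B M r := by
  classical
  obtain ⟨y₀, hy₀, hy₀M⟩ := h.input_mem hk hn hfull
  by_contra! hno
  have hp : ∀ x : {x // Accessible As B (usedLinks M) x},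
      ∃ y : {x // Accessible As B (usedLinks M) x}, (y.1, RightNode.state x.1) ∈ M := by
    rintro ⟨x, hx⟩
    have : ∃ y, (y, RightNode.state x) ∈ M := by
      by_contra! h'
      exact hno x ⟨h', hx⟩
    obtain ⟨y, hy⟩ := this
    rcases h.cases_edge hy with ⟨x', h1, h2⟩ | ⟨h1, -⟩
    · rw [← RightNode.state.inj h1] at h2
      exact ⟨⟨y, hx.step h2⟩, hy⟩
    · cases h1
  choose p hp using hp
  have hinj : Function.Injective p := by
    intro x x' hxx
    have h1 := hp x
    rw [hxx] at h1
    exact Subtype.ext (RightNode.state.inj (Prod.mk.inj (h.isMat.eq_of_fst h1 (hp x') rfl)).2)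
  obtain ⟨x, hx⟩ := (Finite.injective_iff_surjective.1 hinj) ⟨y₀, .of_input hy₀⟩
  have h1 := hp x
  rw [hx] at h1
  have h2 := (Prod.mk.inj (h.isMat.eq_of_fst h1 hy₀M rfl)).2
  cases h2

theorem mem_usedLinks_replace {M : Finset (Edge k n)} {s r z a b : State k n}
    (hab : (a, b) ∈ usedLinks M) (hne : (a, b) ≠ (z, s)) :
    (a, b) ∈ usedLinks (insert (s, RightNode.state r) (M.erase (s, RightNode.state z))) := by
  obtain ⟨h1, h2⟩ := mem_usedLinks.1 hab
  refine mem_usedLinks.2 ⟨h1, Finset.mem_insert_of_mem (Finset.mem_erase.2 ⟨fun h => hne ?_, h2⟩)⟩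
  obtain ⟨h3, h4⟩ := Prod.mk.inj h
  rw [h3, RightNode.state.inj h4]

/-- Redirecting the link at an inaccessible state `s` to an accessible state `r` makes `s`
accessible. -/
theorem accessible_replace {M : Finset (Edge k n)} {s r z : State k n}
    (hr : Accessible As B (usedLinks M) r) (hs : ¬ Accessible As B (usedLinks M) s)
    (hsr : s.1 ≠ r.1) (hz : (z, s) ∈ usedLinks M) :
    Accessible As B
      (usedLinks (insert (s, RightNode.state r) (M.erase (s, RightNode.state z)))) s := by
  refine Accessible.step (x := r) (hr.transfer ?_)
    (Or.inr (mem_usedLinks.2 ⟨hsr.symm, Finset.mem_insert_self _ _⟩))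
  -- The removed link has the inaccessible head `s`, so its tail is inaccessible and no path to an
  -- accessible state used it.
  intro a b hab ha
  left
  refine mem_usedLinks_replace hab fun h => ?_
  obtain ⟨rfl, rfl⟩ := Prod.mk.inj h
  exact hs (ha.step (Or.inr hz))

/-- If `r` lies in another subsystem than `y`, redirecting the link at `y` suffices. Otherwise the
link redirected to `r` is one whose head `s` leads to `x` inside the subsystem of `x`; accessibility
then runs from `r` through `s` and `x` to `y`. -/
theorem Extends.exists_effectiveRepair (hk : 0 < k) (hn : 0 < n)
    (hfull : StructurallyControllable (composite As (allInterconnections k n)) B)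
    {M₀ M : Finset (Edge k n)} (h : Extends As B M₀ M) {y : State k n}
    (hy : ToRepair As B M y) : ∃ M', Repair As B M y M' ∧ EffectiveRepair As B y M' := by
  classical
  obtain ⟨r, hr⟩ := h.exists_unmatchedAccessible hk hn hfull
  obtain ⟨⟨x, hxy, hx⟩, S, hS, hyS, hSacc⟩ := hy
  have hlink : (x, y) ∈ usedLinks M := mem_usedLinks.2 ⟨hxy, hx⟩
  have hyacc : ¬ Accessible As B (usedLinks M) y :=
    fun h' => hSacc (SetAccessible.of_mem (mem_inaccessibleSCCs.1 hS).1 hyS h')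
  have hxacc : ¬ Accessible As B (usedLinks M) x := fun h' => hyacc (h'.step (Or.inr hlink))
  have heff : ∀ M', Accessible As B (usedLinks M') y → EffectiveRepair As B y M' :=
    fun M' h' S' hS' hyS' => SetAccessible.of_mem (mem_inaccessibleSCCs.1 hS').1 hyS' h'
  by_cases hyr : y.1 = r.1
  -- If no link entered the local predecessors of `x`, the matching would map this finite set
  -- injectively into itself, the input being excluded since `x` is inaccessible. Then `x` would be
  -- the partner of one of them, but its partner `y` lies in another subsystem.
  · have hD : ∃ s z, Relation.ReflTransGen (localAdj As) s x ∧ (z, s) ∈ usedLinks M := by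
      by_contra! hno
      have hp : ∀ w : {w // Relation.ReflTransGen (localAdj As) w x},
          ∃ z : {w // Relation.ReflTransGen (localAdj As) w x},
            (w.1, RightNode.state z.1) ∈ M := by
        rintro ⟨w, hw⟩
        obtain ⟨q, hq⟩ := h.isMat.exists_edge h.card_eq w
        rcases h.cases_edge hq with ⟨z, rfl, h2 | h2⟩ | ⟨-, h2⟩
        · exact ⟨⟨z, Relation.ReflTransGen.head h2 hw⟩, hq⟩
        · exact absurd h2 (hno w z hw)
        · exact absurd ((Accessible.of_input h2).of_local hw) hxacc
      choose p hp using hp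
      have hinj : Function.Injective p := by
        intro w w' hww
        have h1 := hp w
        rw [hww] at h1
        exact Subtype.ext (Prod.mk.inj (h.isMat.eq_of_snd h1 (hp w') rfl)).1
      obtain ⟨w, hw⟩ := (Finite.injective_iff_surjective.1 hinj) ⟨x, .refl⟩
      have h1 := hp w
      rw [hw] at h1
      have h2 := (Prod.mk.inj (h.isMat.eq_of_snd h1 hx rfl)).1
      exact hxy (h2 ▸ (fst_eq_of_local w.2).symm)
    obtain ⟨s, z, hsx, hzs⟩ := hD
    have hsx1 : s.1 = x.1 := fst_eq_of_local hsx
    obtain ⟨hzs1, hzsM⟩ := mem_usedLinks.1 hzs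
    have hsr : s.1 ≠ r.1 := by
      rw [hsx1, ← hyr]
      exact hxy
    refine ⟨_, ⟨r, x, hr, hx, Or.inr ⟨hyr, s, z, hsx1, hzs1, hzsM, rfl⟩⟩, heff _ ?_⟩
    have hs := accessible_replace hr.2 (fun h' => hxacc (h'.of_local hsx)) hsr hzs
    -- The link from `x` to `y` has survived: the redirected one has its head `s` in the subsystem
    -- of `x`, not of `y`.
    refine (hs.of_local hsx).step (Or.inr (mem_usedLinks_replace hlink fun h' => ?_))
    rw [(Prod.mk.inj h').2] at hxy
    exact hxy hsx1.symm
  · exact ⟨_, ⟨r, x, hr, hx, Or.inl ⟨hyr, rfl⟩⟩,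
      heff _ (accessible_replace hr.2 hyacc hyr hlink)⟩

/-- An inaccessible component `S` can be entered unless all accessible states lie in its own
subsystem. In that case another subsystem exists, since otherwise `hfull` would make `S` accessible
without links, and a source component there is inaccessible and can be entered from a state at the
input. -/
theorem exists_addLink (hk : 0 < k) (hn : 0 < n)
    (hfull : StructurallyControllable (composite As (allInterconnections k n)) B)
    {M : Finset (Edge k n)} {F : Finset (State k n × State k n)}
    (hF : ¬ ∀ S ∈ inaccessibleSCCs As B, SetAccessible As B (usedLinks M ∪ F) S) :
    ∃ F', AddLink As B M F F' := by
  push Not at hF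
  obtain ⟨S, hS, hSacc⟩ := hF
  obtain ⟨y, hy⟩ := scc_nonempty (mem_inaccessibleSCCs.1 hS).1
  obtain ⟨x₀, hx₀⟩ := exists_input hk hn hfull
  by_cases hx : ∃ x, Accessible As B (usedLinks M ∪ F) x ∧ x.1 ≠ y.1
  · obtain ⟨x, hx, hxy⟩ := hx
    exact ⟨_, S, hS, hSacc, y, hy, x, hx, hxy, rfl⟩
  push Not at hx
  have hz : ∃ z : State k n, z.1 ≠ y.1 := by
    by_contra! hz
    apply hSacc
    intro w _
    refine (hfull.accessible w).mono ?_
    rintro ⟨a, b⟩ hab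
    exact absurd ((hz a).trans (hz b).symm) (mem_allInterconnections.1 hab)
  obtain ⟨z, hz⟩ := hz
  obtain ⟨S', h1, h2, w, hw, hwz⟩ := exists_source (As := As) z
  have hw1 : w.1 ≠ y.1 := by rwa [fst_eq_of_local hwz]
  have hwacc : ¬ Accessible As B (usedLinks M ∪ F) w := fun h' => hw1 (hx w h')
  have hS' : S' ∈ inaccessibleSCCs As B := mem_inaccessibleSCCs.2
    ⟨h1, h2, fun h' => hwacc ((h' w hw).mono (Finset.empty_subset _))⟩
  have hx₀' : Accessible As B (usedLinks M ∪ F) x₀ := .of_input hx₀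
  exact ⟨_, S', hS', fun h' => hwacc (h' w hw), w, hw, x₀, hx₀',
    fun h' => hw1 (h'.symm.trans (hx x₀ hx₀')), rfl⟩

theorem exists_step (hk : 0 < k) (hn : 0 < n)
    (hfull : StructurallyControllable (composite As (allInterconnections k n)) B)
    {s : AlgState k n} (hs : Inv As B s) :
    (∃ I, s = .done I) ∨ ∃ s', Step As B (EffectiveRepair As B) s s' := by
  cases s with
  | start =>
    obtain ⟨M, hM⟩ := exists_isOptimumMatching hk hn hfull
    exact Or.inr ⟨_, .findOptimum M hM⟩
  | optimum M =>
    obtain ⟨K, hK⟩ := exists_isPerfectMatching_minus hk hn hfull hs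
    exact Or.inr ⟨_, .complete M K hK⟩
  | loop M =>
    by_cases h : ∃ y, ToRepair As B M y
    · obtain ⟨y, hy⟩ := h
      exact Or.inr ⟨_, .select M y hy⟩
    · exact Or.inr ⟨_, .leave M (not_exists.1 h)⟩
  | selected M y =>
    obtain ⟨⟨M₀, h⟩, hy⟩ := hs
    obtain ⟨M', h1, h2⟩ := h.exists_effectiveRepair hk hn hfull hy
    exact Or.inr ⟨_, .repair M y M' h1 h2⟩
  | adding M F =>
    by_cases h : ∀ S ∈ inaccessibleSCCs As B, SetAccessible As B (usedLinks M ∪ F) S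
    · exact Or.inr ⟨_, .output M F h⟩
    · obtain ⟨F', hF'⟩ := exists_addLink hk hn hfull h
      exact Or.inr ⟨_, .add M F F' hF'⟩
  | done I => exact Or.inl ⟨I, rfl⟩

/-! ### Termination -/

open Classical in
/-- The number of inaccessible states. -/
noncomputable def inaccCount (As : Matrix (Fin n) (Fin n) Bool)
    (B : Matrix (State k n) (Fin 1) Bool) (F : Finset (State k n × State k n)) : ℕ :=
  (Finset.univ.filter fun x => ¬ Accessible As B F x).card

theorem inaccCount_le (F : Finset (State k n × State k n)) : inaccCount As B F ≤ k * n := by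
  rw [← card_state (k := k) (n := n)]
  exact Finset.card_le_univ _

theorem inaccCount_lt {F F' : Finset (State k n × State k n)}
    (h : ∀ x, Accessible As B F x → Accessible As B F' x) {y : State k n}
    (hy : ¬ Accessible As B F y) (hy' : Accessible As B F' y) :
    inaccCount As B F' < inaccCount As B F := by
  classical
  unfold inaccCount
  apply Finset.card_lt_card
  rw [Finset.ssubset_iff_of_subset]
  · exact ⟨y, by simpa using hy, by simpa using hy'⟩
  · intro x hx
    rw [Finset.mem_filter] at hx ⊢
    exact ⟨hx.1, fun h' => hx.2 (h x h')⟩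

/-- Redirecting a link so that a new state becomes accessible keeps all accessible states
accessible. -/
theorem inaccCount_replace {M : Finset (Edge k n)} {s r z y : State k n}
    (hy : ¬ Accessible As B (usedLinks M) y)
    (hy' : Accessible As B
      (usedLinks (insert (s, RightNode.state r) (M.erase (s, RightNode.state z)))) y) :
    inaccCount As B (usedLinks (insert (s, RightNode.state r) (M.erase (s, RightNode.state z)))) <
      inaccCount As B (usedLinks M) := by
  refine inaccCount_lt (fun x hx => ?_) hy hy'
  set L := usedLinks (insert (s, RightNode.state r) (M.erase (s, RightNode.state z))) with hL
  have hLmem : ∀ a b, (a, b) ∈ L → (a, b) = (r, s) ∨ (a, b) ∈ usedLinks M := by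
    intro a b hab
    obtain ⟨h1, h2⟩ := mem_usedLinks.1 hab
    rcases Finset.mem_insert.1 h2 with h2 | h2
    · obtain ⟨rfl, h3⟩ := Prod.mk.inj h2
      rw [RightNode.state.inj h3]
      exact Or.inl rfl
    · exact Or.inr (mem_usedLinks.2 ⟨h1, Finset.mem_of_mem_erase h2⟩)
  -- The only new link ends at `s`; if `s` were still inaccessible, the new path to `y` would use
  -- old links only. Once `s` is accessible, losing the old link into `s` does no harm.
  have hs : Accessible As B L s := by
    by_contra hs
    refine hy (hy'.transfer fun a b hab ha => Or.inl ?_)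
    rcases hLmem a b hab with h | h
    · obtain ⟨rfl, rfl⟩ := Prod.mk.inj h
      exact absurd (ha.step (Or.inr hab)) hs
    · exact h
  refine hx.transfer fun a b hab _ => ?_
  by_cases h : (a, b) = (z, s)
  · rw [(Prod.mk.inj h).2]
    exact Or.inr hs
  · exact Or.inl (mem_usedLinks_replace hab h)

/-- A measure that decreases along the executions of the algorithm. -/
noncomputable def progress (As : Matrix (Fin n) (Fin n) Bool)
    (B : Matrix (State k n) (Fin 1) Bool) : AlgState k n → ℕ
  -- The factor 2 pays for the two steps, selection and repair, of one pass through the loop, which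
  -- lowers the count by at least one; `k * n` bounds the count before any matching is known.
  | .start => 2 * (k * n) + 5
  | .optimum _ => 2 * (k * n) + 4
  | .loop M => 2 * inaccCount As B (usedLinks M) + 3
  | .selected M _ => 2 * inaccCount As B (usedLinks M) + 2
  | .adding M F => inaccCount As B (usedLinks M ∪ F) + 1
  | .done _ => 0

theorem progress_lt {s s' : AlgState k n} (hs : Inv As B s)
    (hstep : Step As B (EffectiveRepair As B) s s') : progress As B s' < progress As B s := by
  cases hstep with
  | findOptimum M hM => simp [progress]
  | complete M M'' hM =>
    have := inaccCount_le (As := As) (B := B) (usedLinks (M ∩ (edgesX As ∪ edgesU B) ∪ M''))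
    simp only [progress]
    omega
  | select M y hy => simp [progress]
  | repair M y M' hM hok =>
    obtain ⟨-, -, S, hS, hyS, hSacc⟩ := hs
    have h1 : ¬ Accessible As B (usedLinks M) y :=
      fun h => hSacc (SetAccessible.of_mem (mem_inaccessibleSCCs.1 hS).1 hyS h)
    have h2 : Accessible As B (usedLinks M') y := hok S hS hyS y hyS
    have h3 : inaccCount As B (usedLinks M') < inaccCount As B (usedLinks M) := by
      obtain ⟨r, x, -, -, ⟨-, rfl⟩ | ⟨-, s, z, -, -, -, rfl⟩⟩ := hM
      · exact inaccCount_replace h1 h2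
      · exact inaccCount_replace h1 h2
    simp only [progress]
    omega
  | leave M hM =>
    simp only [progress, Finset.union_empty]
    omega
  | add M F F' hF =>
    obtain ⟨S, hS, hSacc, y, hy, x, hx, -, rfl⟩ := hF
    have h1 : ¬ Accessible As B (usedLinks M ∪ F) y :=
      fun h => hSacc (SetAccessible.of_mem (mem_inaccessibleSCCs.1 hS).1 hy h)
    have hsub : usedLinks M ∪ F ⊆ usedLinks M ∪ insert (x, y) F :=
      Finset.union_subset_union le_rfl (Finset.subset_insert _ _)
    have := inaccCount_lt (fun z hz => Accessible.mono hsub hz) h1 ((hx.mono hsub).step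
      (Or.inr (Finset.mem_union_right _ (Finset.mem_insert_self _ _))))
    simp only [progress]
    omega
  | output M F hF => simp [progress]

theorem not_exists_infinite_execution (hk : 0 < k) (hn : 0 < n)
    (hfull : StructurallyControllable (composite As (allInterconnections k n)) B) :
    ¬ ∃ f : ℕ → AlgState k n, f 0 = .start ∧
      ∀ t, Step As B (EffectiveRepair As B) (f t) (f (t + 1)) := by
  rintro ⟨f, h0, hf⟩
  have hreach : ∀ t, Reachable As B (EffectiveRepair As B) (f t) := by
    intro t
    induction t with
    | zero => rw [h0]; exact .refl
    | succ t ih => exact ih.tail (hf t)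
  have hdec : ∀ t, progress As B (f t) + t ≤ progress As B (f 0) := by
    intro t
    induction t with
    | zero => rfl
    | succ t ih =>
      have := progress_lt (Inv.of_reachable hk hn hfull (hreach t)) (hf t)
      omega
  have := hdec (progress As B (f 0) + 1)
  omega

end Progress

end StructComposite

theorem mainTheorem2 (k n : ℕ) (hk : 0 < k) (hn : 0 < n)
    (As : Matrix (Fin n) (Fin n) Bool)
    (B : Matrix (StructComposite.State k n) (Fin 1) Bool)
    (hfull : StructComposite.StructurallyControllable
      (StructComposite.composite As (StructComposite.allInterconnections k n)) B) :
    -- every output, whatever choices are made, is an optimal solution with `β + q` links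
    (∀ I, StructComposite.Reachable As B StructComposite.AnyRepair (.done I) →
      I ⊆ StructComposite.allInterconnections k n ∧
      StructComposite.IsOptimalSolution As B (StructComposite.composite As I) ∧
      (∀ M, StructComposite.IsOptimumMatching As B M →
        I.card = (M ∩ StructComposite.edgesI k n).card +
          (StructComposite.inaccessibleSCCs As B).card) ∧
      (∀ P, StructComposite.IsOptimalSolution As B P →
        (StructComposite.interconnections P).card = I.card)) ∧
    -- an execution can always be continued until it produces an output
    (∀ s, StructComposite.Reachable As B (StructComposite.EffectiveRepair As B) s →
      (∃ I, s = .done I) ∨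
        ∃ s', StructComposite.Step As B (StructComposite.EffectiveRepair As B) s s') ∧
    -- there is no infinite execution
    ¬ ∃ f : ℕ → StructComposite.AlgState k n, f 0 = .start ∧
      ∀ t, StructComposite.Step As B (StructComposite.EffectiveRepair As B) (f t) (f (t + 1)) := by
  exact ⟨fun I hI => StructComposite.output_spec hk hn hfull hI,
    fun s hs => StructComposite.exists_step hk hn hfull
      (StructComposite.Inv.of_reachable hk hn hfull hs),
    StructComposite.not_exists_infinite_execution hk hn hfull⟩
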